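/- **Theorem (General correspondence theorem).** *Conventions.* All spaces are over $\mathbb K\in\{\mathbb R,\mathbb C\}$. Let $(A,G,\alpha)$ be a Banach algebra dynamical system: $A$ is a (not necessarily unital) Banach algebra, $G$ is a locally compact Hausdorff group, and $\alpha$ is a strongly continuous representation of $G$ on $A$ by bounded algebra automorphisms. Fix a left Haar measure $ds$ on $G$. A covariant representation on a Banach space $X$ is a pair $(\pi,U)$ of an algebra homomorphism $\pi:A\to B(X)$ and a group homomorphism $U$ from $G$ into the invertible elements of $B(X)$ such that $\pi(\alpha_s(a))=U_s\pi(a)U_s^{-1}$ for all $s\in G$, $a\in A$. It is *continuous* if $\pi$ is norm bounded and $U$ is strongly continuous. A representation $T$ of an algebra on $X$ is *non-degenerate* if the linear span of all vectors $T(b)x$ is dense in $X$, and $(\pi,U)$ is non-degenerate if $\pi$ is. For continuous $(\pi,U)$ and $f\in C_c(G,A)$ put $\pi\rtimes U(f)x=\int_G\pi(f(s))U_sx\,ds$. Let $\mathcal R$ be a non-empty uniformly bounded class of continuous covariant representations, i.e. there are $C\ge 0$ and a function $\nu:G\to[0,\infty)$, bounded on compact sets, such that $\|\pi\|\le C$ and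 $\|U_r\|\le\nu(r)$ for all $(\pi,U)\in\mathcal R$ and $r\in G$. Let $\sigma^{\mathcal R}(f)=\sup_{(\pi,U)\in\mathcal R}\|\pi\rtimes U(f)\|$. The crossed product $B:=(A\rtimes_\alpha G)^{\mathcal R}$ is the Banach algebra obtained by completing $C_c(G,A)/\ker\sigma^{\mathcal R}$ in the norm induced by $\sigma^{\mathcal R}$, with the multiplication induced by the twisted convolution $[f*g](s)=\int_G f(r)\alpha_r(g(r^{-1}s))\,dr$; $q:C_c(G,A)\to B$ is the canonical map. A covariant representation $(\pi,U)$ on a Banach space $X$ is *$\mathcal R$-continuous* if it is continuous and $\pi\rtimes U:C_c(G,A)\to B(X)$ is bounded with respect to $\sigma^{\mathcal R}$; then $(\pi\rtimes U)^{\mathcal R}$ is the bounded representation of $B$ on $X$ with $(\pi\rtimes U)^{\mathcal R}(q(f))=\pi\rtimes U(f)$. Let $\mathcal M_l(B)\subset B(B)$ be the algebra of bounded operators $L$ on $B$ with $L(ab)=L(a)b$ for all $a,b\in B$, let $\lambda:B\to\mathcal M_l(B)$ be left multiplication, and let $i_A:A\to\mathcal M_l(B)$ and $i_G:G\to\mathcal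 M_l(B)$ be determined by $i_A(a)q(f)=q\bigl(s\mapsto a f(s)\bigr)$ and $i_G(r)q(f)=q\bigl(s\mapsto\alpha_r(f(r^{-1}s))\bigr)$. *Statement.* Suppose that $A$ has a bounded approximate left identity, that all elements of $\mathcal R$ are non-degenerate, and let $\mathcal X$ be a non-empty class of Banach spaces. Let $\mathrm{Cov}$ be the set of non-degenerate $\mathcal R$-continuous covariant representations of $(A,G,\alpha)$ in spaces from $\mathcal X$, and let $\mathrm{Rep}$ be the set of non-degenerate bounded representations of $B$ in spaces from $\mathcal X$. 1. For every $T\in\mathrm{Rep}$, on $X$ say, there is a unique algebra homomorphism $\overline T:\mathcal M_l(B)\to B(X)$ with $\overline T\circ\lambda=T$; it is unital and bounded. 2. The maps $\mathcal I:(\pi,U)\mapsto(\pi\rtimes U)^{\mathcal R}$ and $\mathcal S:T\mapsto(\overline T\circ i_A,\overline T\circ i_G)$ are bijections $\mathcal I:\mathrm{Cov}\to\mathrm{Rep}$ and $\mathcal S:\mathrm{Rep}\to\mathrm{Cov}$, and they are inverse to each other. 3. Both $\mathcal I$ and $\mathcal S$ preserve the set of closed invariant subspaces of an element of their domain (for a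 covariant representation: closed subspaces invariant under both $\pi$ and $U$), and the space of bounded intertwining operators between two elements of their domain. 4. Suppose that $A$ has a bounded involution, that $\alpha_s(a^*)=\alpha_s(a)^*$ for all $s$ and $a$, and that every $(\pi,U)\in\mathcal R$ is involutive, i.e. its space is a Hilbert space, $\pi$ is a $*$-homomorphism and $U$ is unitary. Let $B$ have the involution induced by $f^*(s)=\Delta(s^{-1})\alpha_s(f(s^{-1})^*)$ on $C_c(G,A)$, where $\Delta$ is the modular function, normalised by $\Delta(r)\int_G f(sr)\,ds=\int_G f(s)\,ds$. Then $\mathcal I$ maps involutive elements of $\mathrm{Cov}$ to involutive elements of $\mathrm{Rep}$, and $\mathcal S$ maps involutive elements of $\mathrm{Rep}$ to involutive elements of $\mathrm{Cov}$. -/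

import Mathlib

open MeasureTheory Filter Topology
open scoped CompactlySupported NNReal

namespace CrossedProd

noncomputable section

universe u v w

/-- A Banach space over `𝕜`. A set of such objects is a class of Banach spaces. -/
structure BanachSp (𝕜 : Type u) [RCLike 𝕜] : Type (max u (w + 1)) where
  carrier : Type w
  [normed : NormedAddCommGroup carrier]
  [space : NormedSpace 𝕜 carrier]
  [complete : CompleteSpace carrier]

instance (𝕜 : Type u) [RCLike 𝕜] : CoeSort (BanachSp.{u, w} 𝕜) (Type w) := ⟨BanachSp.carrier⟩

set_option linter.unusedSectionVars false

attribute [instance] BanachSp.normed BanachSp.space BanachSp.complete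

/-- A dynamical system `(A, G, α)`: `act` is a strongly continuous representation of `G` on `A`
by bounded algebra automorphisms (a monoid homomorphism from a group takes values in the
invertible operators). Together with `[CompleteSpace A]` and `G` a locally compact Hausdorff group
this is a Banach algebra dynamical system. -/
structure DynSys (𝕜 : Type*) (A : Type*) (G : Type*) [RCLike 𝕜] [NonUnitalNormedRing A]
    [NormedSpace 𝕜 A] [Group G] [TopologicalSpace G] where
  act : G →* (A →L[𝕜] A)
  act_mul : ∀ (s : G) (a b : A), act s (a * b) = act s a * act s b
  continuous_act : ∀ a : A, Continuous fun s => act s a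

/-- `A` has a bounded approximate left identity: a norm bounded net `u` with `u i * a → a`. -/
def HasBoundedApproxLeftId (A : Type u) [NonUnitalNormedRing A] : Prop :=
  ∃ (ι : Type u) (_ : Preorder ι) (_ : IsDirectedOrder ι) (_ : Nonempty ι) (e : ι → A),
    (∃ M : ℝ, ∀ i, ‖e i‖ ≤ M) ∧ ∀ a : A, Tendsto (fun i => e i * a) atTop (𝓝 a)

/-! ### Representations of algebras -/

section AlgRep

variable {𝕜 B X Y : Type*} [RCLike 𝕜] [NonUnitalNormedRing B] [NormedSpace 𝕜 B]
  [NormedAddCommGroup X] [NormedSpace 𝕜 X] [NormedAddCommGroup Y] [NormedSpace 𝕜 Y]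

/-- The representation `T` is norm bounded. -/
def IsBddRep (T : B →ₙₐ[𝕜] (X →L[𝕜] X)) : Prop := ∃ C : ℝ, ∀ b, ‖T b‖ ≤ C * ‖b‖

/-- The representation `T` is non-degenerate: the span of all `T b x` is dense. -/
def IsNondegRep (T : B →ₙₐ[𝕜] (X →L[𝕜] X)) : Prop :=
  Dense (Submodule.span 𝕜 {y : X | ∃ b x, y = T b x} : Set X)

/-- The subspace `Z` is invariant under the representation `T`. -/
def IsInvariantRep (T : B →ₙₐ[𝕜] (X →L[𝕜] X)) (Z : Submodule 𝕜 X) : Prop :=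
  ∀ b, ∀ z ∈ Z, T b z ∈ Z

/-- The bounded operator `Φ` intertwines `T` and `S`. -/
def IntertwinesRep (T : B →ₙₐ[𝕜] (X →L[𝕜] X)) (S : B →ₙₐ[𝕜] (Y →L[𝕜] Y)) (Φ : X →L[𝕜] Y) : Prop :=
  ∀ b, (S b).comp Φ = Φ.comp (T b)

/-- `X` with its given norm is a Hilbert space with inner product `c`
(this is used for complete spaces `X` only). -/
def IsHilbertCore (c : InnerProductSpace.Core 𝕜 X) : Prop :=
  ∀ x : X, RCLike.re (c.inner x x) = ‖x‖ ^ 2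

/-- With respect to the map `st` as involution on `B`, the representation `T` is involutive:
its space is a Hilbert space, and `T (st b)` is the adjoint of `T b`. -/
def IsInvolutiveRep (st : B → B) (T : B →ₙₐ[𝕜] (X →L[𝕜] X)) : Prop :=
  ∃ c : InnerProductSpace.Core 𝕜 X, IsHilbertCore c ∧
    ∀ b x y, c.inner (T (st b) x) y = c.inner x (T b y)

end AlgRep

/-! ### The vector valued integral -/

section Vint

variable {G H E F : Type*} (𝕜 : Type*) [RCLike 𝕜] [NormedAddCommGroup E] [NormedSpace 𝕜 E]
  [NormedAddCommGroup F] [NormedSpace 𝕜 F] [MeasurableSpace G] [MeasurableSpace H]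

/-- The Bochner integral `∫ f(s) dμ(s)` in a normed space over `𝕜`, considered as a normed space
over `ℝ` by restriction of scalars. -/
def vint (μ : Measure G) (f : G → E) : E :=
  letI : NormedSpace ℝ E := NormedSpace.restrictScalars ℝ 𝕜 E
  ∫ s, f s ∂μ

variable (μ : Measure G) (ν : Measure H) {f g : G → E}

lemma vint_add (hf : Integrable f μ) (hg : Integrable g μ) :
    vint 𝕜 μ (fun s => f s + g s) = vint 𝕜 μ f + vint 𝕜 μ g := by
  let : NormedSpace ℝ E := NormedSpace.restrictScalars ℝ 𝕜 E
  exact integral_add hf hg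

lemma vint_smul (c : 𝕜) : vint 𝕜 μ (fun s => c • f s) = c • vint 𝕜 μ f := by
  let : NormedSpace ℝ E := NormedSpace.restrictScalars ℝ 𝕜 E
  exact integral_smul _ _

lemma norm_vint_le {φ : G → ℝ} (hφ : Integrable φ μ) (h : ∀ s, ‖f s‖ ≤ φ s) :
    ‖vint 𝕜 μ f‖ ≤ ∫ s, φ s ∂μ := by
  let : NormedSpace ℝ E := NormedSpace.restrictScalars ℝ 𝕜 E
  exact norm_integral_le_of_norm_le hφ (Eventually.of_forall h)

lemma vint_eq_zero (h : ∀ s, f s = 0) : vint 𝕜 μ f = 0 := by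
  let : NormedSpace ℝ E := NormedSpace.restrictScalars ℝ 𝕜 E
  exact integral_eq_zero_of_ae (Eventually.of_forall h)

lemma vint_clm [CompleteSpace E] [CompleteSpace F] (L : E →L[𝕜] F) (hf : Integrable f μ) :
    vint 𝕜 μ (fun s => L (f s)) = L (vint 𝕜 μ f) := by
  let : NormedSpace ℝ E := NormedSpace.restrictScalars ℝ 𝕜 E
  let : NormedSpace ℝ F := NormedSpace.restrictScalars ℝ 𝕜 F
  exact L.integral_comp_comm hf

lemma continuous_vint [TopologicalSpace G] [TopologicalSpace H] [OpensMeasurableSpace G]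
    [IsFiniteMeasureOnCompacts μ] {k : Set G} (hk : IsCompact k) {f : H → G → E}
    (hf : Continuous f.uncurry) (hfs : ∀ p x, x ∉ k → f p x = 0) :
    Continuous fun p => vint 𝕜 μ (f p) := by
  let : NormedSpace ℝ E := NormedSpace.restrictScalars ℝ 𝕜 E
  rw [← continuousOn_univ]
  exact continuousOn_integral_of_compact_support hk hf.continuousOn fun p x _ hx => hfs p x hx

lemma vint_swap [TopologicalSpace G] [TopologicalSpace H] [OpensMeasurableSpace G]
    [OpensMeasurableSpace H] [IsFiniteMeasureOnCompacts μ] [IsFiniteMeasureOnCompacts ν]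
    {f : G → H → E} (hf : Continuous f.uncurry) (hfs : HasCompactSupport f.uncurry) :
    vint 𝕜 μ (fun s => vint 𝕜 ν (f s)) = vint 𝕜 ν (fun r => vint 𝕜 μ (fun s => f s r)) := by
  let : NormedSpace ℝ E := NormedSpace.restrictScalars ℝ 𝕜 E
  exact integral_integral_swap_of_hasCompactSupport hf hfs

lemma vint_mul_left [Group G] [MeasurableMul G] [μ.IsMulLeftInvariant] (r : G) :
    vint 𝕜 μ (fun s => f (r * s)) = vint 𝕜 μ f := by
  let : NormedSpace ℝ E := NormedSpace.restrictScalars ℝ 𝕜 E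
  exact integral_mul_left_eq_self f r

end Vint

section System

variable {𝕜 A G : Type*} [RCLike 𝕜] [NonUnitalNormedRing A] [NormedSpace 𝕜 A]
  [Group G] [TopologicalSpace G]

/-! ### Covariant representations -/

/-- A covariant representation `(π, U)` of `(A, G, α)` on `X`. -/
structure CovRep (D : DynSys 𝕜 A G) (X : Type*) [NormedAddCommGroup X] [NormedSpace 𝕜 X] where
  pi : A →ₙₐ[𝕜] (X →L[𝕜] X)
  U : G →* (X →L[𝕜] X)
  covariant : ∀ (s : G) (a : A), pi (D.act s a) = U s * pi a * U s⁻¹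

namespace CovRep

variable {D : DynSys 𝕜 A G} {X Y : Type*} [NormedAddCommGroup X] [NormedSpace 𝕜 X]
  [NormedAddCommGroup Y] [NormedSpace 𝕜 Y]

/-- `π` is norm bounded and `U` is strongly continuous. -/
def IsContinuous (ρ : CovRep D X) : Prop :=
  IsBddRep ρ.pi ∧ ∀ x : X, Continuous fun s => ρ.U s x

/-- `π` is non-degenerate. -/
def IsNondeg (ρ : CovRep D X) : Prop := IsNondegRep ρ.pi

/-- The subspace `Z` is invariant under both `π` and `U`. -/
def IsInvariant (ρ : CovRep D X) (Z : Submodule 𝕜 X) : Prop :=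
  IsInvariantRep ρ.pi Z ∧ ∀ s, ∀ z ∈ Z, ρ.U s z ∈ Z

/-- The bounded operator `Φ` intertwines both components. -/
def Intertwines (ρ : CovRep D X) (τ : CovRep D Y) (Φ : X →L[𝕜] Y) : Prop :=
  IntertwinesRep ρ.pi τ.pi Φ ∧ ∀ s, (τ.U s).comp Φ = Φ.comp (ρ.U s)

/-- `(π, U)` is involutive: for a Hilbert space structure on its space, `π` is involutive and
`U` is unitary. (Each `U s` is invertible, so that unitary means inner product preserving.) -/
def IsInvolutive [Star A] (ρ : CovRep D X) : Prop :=
  ∃ c : InnerProductSpace.Core 𝕜 X, IsHilbertCore c ∧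
    (∀ a x y, c.inner (ρ.pi (star a) x) y = c.inner x (ρ.pi a y)) ∧
    ∀ s x y, c.inner (ρ.U s x) (ρ.U s y) = c.inner x y

/-- The pair `(0, 1)`. -/
def trivial (D : DynSys 𝕜 A G) (X : Type*) [NormedAddCommGroup X] [NormedSpace 𝕜 X] :
    CovRep D X where
  pi := 0
  U := 1
  covariant := by intro s a; simp

end CovRep

/-- A non-empty uniformly bounded class of continuous covariant representations. -/
structure RepClass (D : DynSys 𝕜 A G) where
  carrier : Set (Σ X : BanachSp.{_, v} 𝕜, CovRep D X)
  nonempty : carrier.Nonempty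
  isContinuous : ∀ ρ ∈ carrier, ρ.2.IsContinuous
  uniformlyBounded : ∃ (C : ℝ≥0) (ν : G → ℝ≥0), (∀ K : Set G, IsCompact K → BddAbove (ν '' K)) ∧
    ∀ ρ ∈ carrier, (∀ a, ‖ρ.2.pi a‖ ≤ C * ‖a‖) ∧ ∀ r, ‖ρ.2.U r‖ ≤ ν r

/-! ### Twisted convolution and integrated forms -/

/-- A strongly continuous group representation is bounded on compact sets. -/
lemma exists_bound_of_isCompact {E : Type*} [NormedAddCommGroup E] [NormedSpace 𝕜 E]
    [CompleteSpace E] (V : G →* (E →L[𝕜] E)) (hV : ∀ x, Continuous fun s => V s x)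
    {K : Set G} (hK : IsCompact K) : ∃ M : ℝ, 0 ≤ M ∧ ∀ s ∈ K, ‖V s‖ ≤ M := by
  obtain ⟨M, hM⟩ := banach_steinhaus (g := fun s : K => V s) (fun x => by
    obtain ⟨C, hC⟩ := (hK.image (hV x).norm).bddAbove
    exact ⟨C, fun s => hC ⟨s, s.2, rfl⟩⟩)
  exact ⟨max M 0, le_max_right _ _, fun s hs => (hM ⟨s, hs⟩).trans (le_max_left _ _)⟩

lemma DynSys.continuous_uncurry [LocallyCompactSpace G] [CompleteSpace A] (D : DynSys 𝕜 A G) :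
    Continuous fun p : G × A => D.act p.1 p.2 := by
  rw [continuous_iff_continuousAt]
  rintro ⟨s, a⟩
  obtain ⟨K, hK, hKs⟩ := exists_compact_mem_nhds s
  obtain ⟨M, hM0, hM⟩ := exists_bound_of_isCompact D.act D.continuous_act hK
  have h1 : Tendsto (fun p : G × A => M * ‖p.2 - a‖ + ‖D.act p.1 a - D.act s a‖) (𝓝 (s, a))
      (𝓝 0) := by
    have : Continuous fun p : G × A => M * ‖p.2 - a‖ + ‖D.act p.1 a - D.act s a‖ := by
      have := (D.continuous_act a).comp (continuous_fst (X := G) (Y := A))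
      simp only [Function.comp_def] at this
      fun_prop
    simpa using this.tendsto (s, a)
  rw [ContinuousAt, tendsto_iff_norm_sub_tendsto_zero]
  refine squeeze_zero' (Eventually.of_forall fun _ => norm_nonneg _) ?_ h1
  have : ∀ᶠ p : G × A in 𝓝 (s, a), p.1 ∈ K := continuous_fst.continuousAt hKs
  filter_upwards [this] with p hp
  calc ‖D.act p.1 p.2 - D.act s a‖
      = ‖D.act p.1 (p.2 - a) + (D.act p.1 a - D.act s a)‖ := by rw [map_sub]; congr 1; abel
    _ ≤ ‖D.act p.1 (p.2 - a)‖ + ‖D.act p.1 a - D.act s a‖ := norm_add_le _ _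
    _ ≤ _ := by
      gcongr
      exact (D.act p.1).le_of_opNorm_le (hM _ hp) _

variable [IsTopologicalGroup G] [LocallyCompactSpace G] [CompleteSpace A] [MeasurableSpace G]
  [BorelSpace G]

lemma DynSys.continuous_conv_integrand (D : DynSys 𝕜 A G) (f g : C_c(G, A)) :
    Continuous fun p : G × G => f p.2 * D.act p.2 (g (p.2⁻¹ * p.1)) := by
  have h : Continuous fun p : G × G => D.act p.2 (g (p.2⁻¹ * p.1)) :=
    D.continuous_uncurry.comp (f := fun p : G × G => (p.2, g (p.2⁻¹ * p.1))) (by fun_prop)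
  fun_prop

/-- The twisted convolution `[f * g](s) = ∫ f(r) α_r(g(r⁻¹ s)) dr` on `C_c(G, A)`. -/
def DynSys.conv (D : DynSys 𝕜 A G) (μ : Measure G) [IsFiniteMeasureOnCompacts μ]
    (f g : C_c(G, A)) : C_c(G, A) where
  toFun s := vint 𝕜 μ fun r => f r * D.act r (g (r⁻¹ * s))
  continuous_toFun := continuous_vint 𝕜 μ f.hasCompactSupport
    (D.continuous_conv_integrand f g) fun s r hr => by
      simp [image_eq_zero_of_notMem_tsupport hr]
  hasCompactSupport' := by
    refine HasCompactSupport.of_support_subset_isCompact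
      (K := (fun p : G × G => p.1 * p.2) '' (tsupport f ×ˢ tsupport g))
      ((f.hasCompactSupport.prod g.hasCompactSupport).image continuous_mul) ?_
    intro s hs
    by_contra hn
    refine hs ?_
    refine vint_eq_zero 𝕜 μ fun r => ?_
    by_cases hr : r ∈ tsupport f
    · have : r⁻¹ * s ∉ tsupport g := fun h => hn ⟨(r, r⁻¹ * s), ⟨hr, h⟩, by simp⟩
      simp [image_eq_zero_of_notMem_tsupport this]
    · simp [image_eq_zero_of_notMem_tsupport hr]

namespace CovRep

variable {D : DynSys 𝕜 A G} {X : Type*} [NormedAddCommGroup X] [NormedSpace 𝕜 X]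
  [CompleteSpace X]

/-- `π` as a bounded operator. -/
def piL (ρ : CovRep D X) (h : ρ.IsContinuous) : A →L[𝕜] (X →L[𝕜] X) :=
  LinearMap.mkContinuousOfExistsBound (ρ.pi : A →ₗ[𝕜] (X →L[𝕜] X)) h.1

@[simp] lemma piL_apply (ρ : CovRep D X) (h : ρ.IsContinuous) (a : A) :
    ρ.piL h a = ρ.pi a := rfl

lemma continuous_integrand (ρ : CovRep D X) (h : ρ.IsContinuous) (f : C_c(G, A)) (x : X) :
    Continuous fun s => ρ.pi (f s) (ρ.U s x) :=
  ((ρ.piL h).continuous.comp f.continuous).clm_apply (h.2 x)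

lemma hasCompactSupport_integrand (ρ : CovRep D X) (f : C_c(G, A)) (x : X) :
    HasCompactSupport fun s => ρ.pi (f s) (ρ.U s x) :=
  f.hasCompactSupport.mono fun s hs hf => hs (by simp [hf])

lemma integrable_integrand (ρ : CovRep D X) (h : ρ.IsContinuous) (μ : Measure G)
    [IsFiniteMeasureOnCompacts μ] (f : C_c(G, A)) (x : X) :
    Integrable (fun s => ρ.pi (f s) (ρ.U s x)) μ :=
  (ρ.continuous_integrand h f x).integrable_of_hasCompactSupport
    (ρ.hasCompactSupport_integrand f x)

lemma norm_integral_le (ρ : CovRep D X) (μ : Measure G) [IsFiniteMeasureOnCompacts μ]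
    (f : C_c(G, A)) {C M : ℝ} (hC : ∀ a, ‖ρ.pi a‖ ≤ C * ‖a‖)
    (hM : ∀ s ∈ tsupport f, ‖ρ.U s‖ ≤ M) (x : X) :
    ‖vint 𝕜 μ fun s => ρ.pi (f s) (ρ.U s x)‖ ≤ (C * M * ∫ s, ‖f s‖ ∂μ) * ‖x‖ := by
  have hf : Integrable (fun s => ‖f s‖) μ :=
    (f.continuous.integrable_of_hasCompactSupport f.hasCompactSupport).norm
  have : ∫ s, C * M * ‖x‖ * ‖f s‖ ∂μ = (C * M * ∫ s, ‖f s‖ ∂μ) * ‖x‖ := by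
    rw [integral_const_mul]; ring
  rw [← this]
  refine norm_vint_le 𝕜 μ (hf.const_mul _) fun s => ?_
  by_cases hs : s ∈ tsupport f
  · calc ‖ρ.pi (f s) (ρ.U s x)‖ ≤ (C * ‖f s‖) * (M * ‖x‖) :=
          (ρ.pi (f s)).le_of_opNorm_le_of_le (hC _) ((ρ.U s).le_of_opNorm_le (hM s hs) x)
      _ = _ := by ring
  · simp [image_eq_zero_of_notMem_tsupport hs]

/-- The integrated form `π ⋊ U (f) = ∫ π(f(s)) U_s ds`, the integral being taken pointwise
on `X`. -/
def integrated (ρ : CovRep D X) (h : ρ.IsContinuous) (μ : Measure G)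
    [IsFiniteMeasureOnCompacts μ] : C_c(G, A) →ₗ[𝕜] (X →L[𝕜] X) where
  toFun f := LinearMap.mkContinuousOfExistsBound
    { toFun := fun x => vint 𝕜 μ fun s => ρ.pi (f s) (ρ.U s x)
      map_add' := fun x y => by
        simp only [map_add]
        exact vint_add 𝕜 μ (ρ.integrable_integrand h μ f x) (ρ.integrable_integrand h μ f y)
      map_smul' := fun c x => by
        simp only [map_smul, RingHom.id_apply]
        exact vint_smul 𝕜 μ c }
    (by
      obtain ⟨C, hC⟩ := h.1
      obtain ⟨M, -, hM⟩ := exists_bound_of_isCompact ρ.U h.2 f.hasCompactSupport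
      exact ⟨_, ρ.norm_integral_le μ f hC hM⟩)
  map_add' f g := by
    ext x
    have := vint_add 𝕜 μ (ρ.integrable_integrand h μ f x) (ρ.integrable_integrand h μ g x)
    simpa using this
  map_smul' c f := by
    ext x
    have := vint_smul 𝕜 μ (f := fun s => ρ.pi (f s) (ρ.U s x)) c
    simpa using this

lemma integrated_apply (ρ : CovRep D X) (h : ρ.IsContinuous) (μ : Measure G)
    [IsFiniteMeasureOnCompacts μ] (f : C_c(G, A)) (x : X) :
    ρ.integrated h μ f x = vint 𝕜 μ fun s => ρ.pi (f s) (ρ.U s x) := rfl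

lemma norm_integrated_le (ρ : CovRep D X) (h : ρ.IsContinuous) (μ : Measure G)
    [IsFiniteMeasureOnCompacts μ]
    (f : C_c(G, A)) {C M : ℝ} (hC0 : 0 ≤ C) (hM0 : 0 ≤ M) (hC : ∀ a, ‖ρ.pi a‖ ≤ C * ‖a‖)
    (hM : ∀ s ∈ tsupport f, ‖ρ.U s‖ ≤ M) :
    ‖ρ.integrated h μ f‖ ≤ C * M * ∫ s, ‖f s‖ ∂μ :=
  ContinuousLinearMap.opNorm_le_bound _
    (mul_nonneg (mul_nonneg hC0 hM0) (integral_nonneg fun _ => norm_nonneg _))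
    (ρ.norm_integral_le μ f hC hM)

lemma U_mul_apply (ρ : CovRep D X) (s t : G) (x : X) : ρ.U (s * t) x = ρ.U s (ρ.U t x) := by
  rw [map_mul]; rfl

lemma U_mul_pi (ρ : CovRep D X) (s : G) (a : A) (x : X) :
    ρ.U s (ρ.pi a x) = ρ.pi (D.act s a) (ρ.U s x) := by
  rw [ρ.covariant]
  simp [← U_mul_apply]

/-- The integrated form is multiplicative. -/
lemma integrated_conv (ρ : CovRep D X) (h : ρ.IsContinuous) (μ : Measure G)
    [μ.IsHaarMeasure] (f g : C_c(G, A)) :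
    ρ.integrated h μ (D.conv μ f g) = ρ.integrated h μ f * ρ.integrated h μ g := by
  ext x
  have h1 : ∀ s, ρ.pi (D.conv μ f g s) (ρ.U s x)
      = vint 𝕜 μ fun r => ρ.pi (f r) (ρ.pi (D.act r (g (r⁻¹ * s))) (ρ.U s x)) := by
    intro s
    have hint : Integrable (fun r => f r * D.act r (g (r⁻¹ * s))) μ := by
      refine Continuous.integrable_of_hasCompactSupport
        ((D.continuous_conv_integrand f g).comp (f := fun r => (s, r)) (by fun_prop)) ?_
      exact f.hasCompactSupport.mono fun r hr hf => hr (by simp [hf])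
    have := vint_clm 𝕜 μ ((ContinuousLinearMap.apply 𝕜 X (ρ.U s x)).comp (ρ.piL h)) hint
    simp only [ContinuousLinearMap.comp_apply, piL_apply, ContinuousLinearMap.apply_apply] at this
    change ρ.pi (vint 𝕜 μ fun r => f r * D.act r (g (r⁻¹ * s))) (ρ.U s x) = _
    rw [← this]
    simp
  have hcont : Continuous (Function.uncurry fun s r =>
      ρ.pi (f r) (ρ.pi (D.act r (g (r⁻¹ * s))) (ρ.U s x))) := by
    have h2 : Continuous fun p : G × G =>
        (ρ.piL h) (f p.2 * D.act p.2 (g (p.2⁻¹ * p.1))) :=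
      (ρ.piL h).continuous.comp (D.continuous_conv_integrand f g)
    have h3 := h2.clm_apply ((h.2 x).comp (continuous_fst (X := G) (Y := G)))
    refine h3.congr fun p => ?_
    simp [Function.uncurry]
  have hsupp : HasCompactSupport (Function.uncurry fun s r =>
      ρ.pi (f r) (ρ.pi (D.act r (g (r⁻¹ * s))) (ρ.U s x))) := by
    refine HasCompactSupport.of_support_subset_isCompact
      (K := (fun p : G × G => (p.1 * p.2, p.1)) '' (tsupport f ×ˢ tsupport g))
      ((f.hasCompactSupport.prod g.hasCompactSupport).image (by fun_prop)) ?_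
    rintro ⟨s, r⟩ hs
    by_contra hn
    refine hs ?_
    by_cases hr : r ∈ tsupport f
    · have : r⁻¹ * s ∉ tsupport g := fun h => hn ⟨(r, r⁻¹ * s), ⟨hr, h⟩, by simp⟩
      simp [Function.uncurry, image_eq_zero_of_notMem_tsupport this]
    · simp [Function.uncurry, image_eq_zero_of_notMem_tsupport hr]
  rw [integrated_apply]
  simp only [h1]
  rw [vint_swap 𝕜 μ μ hcont hsupp, mul_apply_eq_comp,
    integrated_apply]
  congr 1
  ext r
  rw [← vint_mul_left 𝕜 μ r]
  simp only [inv_mul_cancel_left, U_mul_apply, ← U_mul_pi]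
  rw [integrated_apply]
  exact vint_clm 𝕜 μ ((ρ.pi (f r)).comp (ρ.U r)) (ρ.integrable_integrand h μ g x)

end CovRep


/-! ### The crossed product -/

namespace RepClass

variable [IsScalarTower 𝕜 A A] [SMulCommClass 𝕜 A A]

variable {D : DynSys 𝕜 A G} (R : RepClass.{v} D) (μ : Measure G) [μ.IsHaarMeasure]

/-- The norm of the integrated form at `f` of an element of the class. -/
def normAt (f : C_c(G, A)) (ρ : R.carrier) : ℝ :=
  ‖ρ.1.2.integrated (R.isContinuous _ ρ.2) μ f‖

lemma bddAbove_normAt (f : C_c(G, A)) : BddAbove (Set.range (R.normAt μ f)) := by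
  obtain ⟨C, ν, hν, h⟩ := R.uniformlyBounded
  obtain ⟨M, hM⟩ := hν _ f.hasCompactSupport
  refine ⟨C * M * ∫ s, ‖f s‖ ∂μ, ?_⟩
  rintro _ ⟨ρ, rfl⟩
  exact ρ.1.2.norm_integrated_le _ μ f C.2 M.2 (h _ ρ.2).1 fun s hs =>
    ((h _ ρ.2).2 s).trans (NNReal.coe_le_coe.2 (hM ⟨s, hs, rfl⟩))

/-- The seminorm `σ(f) = sup ‖π ⋊ U (f)‖` on `C_c(G, A)`, over all `(π, U)` in the class. -/
def sigma : Seminorm 𝕜 C_c(G, A) :=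
  Seminorm.ofSMulLE (fun f => ⨆ ρ : R.carrier, R.normAt μ f ρ)
    (by simp [normAt])
    (fun f g => by
      have := R.nonempty.to_subtype
      refine ciSup_le fun ρ => ?_
      refine (?_ : _ ≤ R.normAt μ f ρ + R.normAt μ g ρ).trans
        (add_le_add (le_ciSup (R.bddAbove_normAt μ f) ρ) (le_ciSup (R.bddAbove_normAt μ g) ρ))
      simp only [normAt, map_add]
      exact norm_add_le _ _)
    (fun c f => by
      have := R.nonempty.to_subtype
      refine ciSup_le fun ρ => ?_
      simp only [normAt, map_smul, norm_smul]
      gcongr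
      exact le_ciSup (R.bddAbove_normAt μ f) ρ)

lemma sigma_apply (f : C_c(G, A)) : R.sigma μ f = ⨆ ρ : R.carrier, R.normAt μ f ρ := rfl

lemma normAt_le_sigma (f : C_c(G, A)) (ρ : R.carrier) : R.normAt μ f ρ ≤ R.sigma μ f :=
  le_ciSup (R.bddAbove_normAt μ f) ρ

lemma sigma_le {f : C_c(G, A)} {C : ℝ} (h : ∀ ρ, R.normAt μ f ρ ≤ C) : R.sigma μ f ≤ C := by
  have := R.nonempty.to_subtype
  exact ciSup_le h

lemma sigma_conv_le (f g : C_c(G, A)) :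
    R.sigma μ (D.conv μ f g) ≤ R.sigma μ f * R.sigma μ g := by
  refine R.sigma_le μ fun ρ => ?_
  refine (?_ : _ ≤ R.normAt μ f ρ * R.normAt μ g ρ).trans
    (mul_le_mul (R.normAt_le_sigma μ f ρ) (R.normAt_le_sigma μ g ρ) (norm_nonneg _)
      (apply_nonneg _ _))
  simp only [normAt, CovRep.integrated_conv]
  exact norm_mul_le _ _

/-- Criterion for equality in the quotient of `C_c(G, A)` by the kernel of `σ`. -/
lemma sigma_eq_zero {f : C_c(G, A)}
    (h : ∀ ρ : R.carrier, ρ.1.2.integrated (R.isContinuous _ ρ.2) μ f = 0) :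
    R.sigma μ f = 0 :=
  le_antisymm (R.sigma_le μ fun ρ => by simp [normAt, h]) (apply_nonneg _ _)

/-- `C_c(G, A)`, to be equipped with the seminorm `σ`. -/
def Pre (_R : RepClass.{v} D) (_μ : Measure G) : Type _ := C_c(G, A)

instance : AddCommGroup (R.Pre μ) := inferInstanceAs (AddCommGroup C_c(G, A))
instance : Module 𝕜 (R.Pre μ) := inferInstanceAs (Module 𝕜 C_c(G, A))
instance : SeminormedAddCommGroup (R.Pre μ) :=
  { AddGroupSeminorm.toSeminormedAddCommGroup (E := R.Pre μ) (R.sigma μ).toAddGroupSeminorm with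
    toAddCommGroup := inferInstance }
instance : NormedSpace 𝕜 (R.Pre μ) where
  norm_smul_le c f := (map_smul_eq_mul (R.sigma μ) c f).le

/-- The identity map from `C_c(G, A)`. -/
def toPre : C_c(G, A) ≃ₗ[𝕜] R.Pre μ := LinearEquiv.refl 𝕜 _

lemma norm_toPre (f : C_c(G, A)) : ‖R.toPre μ f‖ = R.sigma μ f := rfl

/-- The crossed product `(A ⋊ G)^R`: the (Hausdorff) completion of `C_c(G, A)` with respect to
the seminorm `σ`, i.e. the completion of the quotient of `C_c(G, A)` by the kernel of `σ`. -/
abbrev CP : Type _ := UniformSpace.Completion (R.Pre μ)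

/-- The canonical map `q : C_c(G, A) → (A ⋊ G)^R`. -/
def q : C_c(G, A) →ₗ[𝕜] R.CP μ :=
  (UniformSpace.Completion.toComplₗᵢ (𝕜 := 𝕜)).toLinearMap ∘ₗ (R.toPre μ).toLinearMap

lemma norm_q (f : C_c(G, A)) : ‖R.q μ f‖ = R.sigma μ f := by
  change ‖((R.toPre μ f : R.Pre μ) : R.CP μ)‖ = _
  rw [UniformSpace.Completion.norm_coe, norm_toPre]

lemma denseRange_q : DenseRange (R.q μ) :=
  UniformSpace.Completion.denseRange_coe (α := R.Pre μ)

lemma q_eq_of_integrated_eq {f g : C_c(G, A)}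
    (h : ∀ ρ : R.carrier, ρ.1.2.integrated (R.isContinuous _ ρ.2) μ f
      = ρ.1.2.integrated (R.isContinuous _ ρ.2) μ g) : R.q μ f = R.q μ g := by
  rw [← sub_eq_zero, ← map_sub, ← norm_eq_zero, norm_q]
  exact R.sigma_eq_zero μ fun ρ => by rw [map_sub, h, sub_self]

/-- The extension to the crossed product of a `σ`-bounded linear map on `C_c(G, A)`. -/
def extCP {E : Type*} [NormedAddCommGroup E] [NormedSpace 𝕜 E] [CompleteSpace E]
    (T : C_c(G, A) →ₗ[𝕜] E) (hT : ∃ C : ℝ, ∀ f, ‖T f‖ ≤ C * R.sigma μ f) : R.CP μ →L[𝕜] E :=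
  (LinearMap.mkContinuousOfExistsBound (T ∘ₗ (R.toPre μ).symm.toLinearMap) hT).extend
    (UniformSpace.Completion.toComplL (𝕜 := 𝕜))

lemma extCP_q {E : Type*} [NormedAddCommGroup E] [NormedSpace 𝕜 E] [CompleteSpace E]
    (T : C_c(G, A) →ₗ[𝕜] E) (hT : ∃ C : ℝ, ∀ f, ‖T f‖ ≤ C * R.sigma μ f) (f : C_c(G, A)) :
    R.extCP μ T hT (R.q μ f) = T f :=
  ContinuousLinearMap.extend_eq _ UniformSpace.Completion.denseRange_coe
    (UniformSpace.Completion.isUniformInducing_coe _) _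

lemma CP_induction {P : R.CP μ → Prop} (hP : IsClosed {c | P c}) (h : ∀ f, P (R.q μ f))
    (c : R.CP μ) : P c := (R.denseRange_q μ).induction_on c hP h

lemma CP_hom_ext {E : Type*} [NormedAddCommGroup E] [NormedSpace 𝕜 E] {T S : R.CP μ →L[𝕜] E}
    (h : ∀ f, T (R.q μ f) = S (R.q μ f)) : T = S :=
  ContinuousLinearMap.ext fun c =>
    R.CP_induction μ (isClosed_eq T.continuous S.continuous) h c

lemma integrable_conv (f g : C_c(G, A)) (s : G) :
    Integrable (fun r => f r * D.act r (g (r⁻¹ * s))) μ := by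
  refine Continuous.integrable_of_hasCompactSupport
    ((D.continuous_conv_integrand f g).comp (f := fun r => (s, r)) (by fun_prop)) ?_
  exact f.hasCompactSupport.mono fun r hr hf => hr (by simp [hf])

/-- Convolution as a bilinear map. -/
def convₗ (D : DynSys 𝕜 A G) (μ : Measure G) [μ.IsHaarMeasure] :
    C_c(G, A) →ₗ[𝕜] C_c(G, A) →ₗ[𝕜] C_c(G, A) :=
  LinearMap.mk₂ 𝕜 (D.conv μ)
    (fun f f' g => by
      ext s
      refine Eq.trans ?_ (vint_add 𝕜 μ (integrable_conv μ f g s) (integrable_conv μ f' g s))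
      exact congrArg (vint 𝕜 μ) (funext fun r => add_mul _ _ _))
    (fun c f g => by
      ext s
      refine Eq.trans ?_ (vint_smul 𝕜 μ c)
      exact congrArg (vint 𝕜 μ) (funext fun r => smul_mul_assoc _ _ _))
    (fun f g g' => by
      ext s
      refine Eq.trans ?_ (vint_add 𝕜 μ (integrable_conv μ f g s) (integrable_conv μ f g' s))
      exact congrArg (vint 𝕜 μ) (funext fun r => by simp [mul_add]))
    (fun c f g => by
      ext s
      refine Eq.trans ?_ (vint_smul 𝕜 μ c)
      exact congrArg (vint 𝕜 μ) (funext fun r => by simp [mul_smul_comm]))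

lemma convₗ_apply (D : DynSys 𝕜 A G) (μ : Measure G) [μ.IsHaarMeasure] (f g : C_c(G, A)) :
    convₗ D μ f g = D.conv μ f g := rfl

lemma mulL_bound (f g : C_c(G, A)) :
    ‖(R.q μ ∘ₗ convₗ D μ f) g‖ ≤ R.sigma μ f * R.sigma μ g := by
  rw [LinearMap.comp_apply, convₗ_apply, norm_q]
  exact R.sigma_conv_le μ f g

/-- Multiplication of the crossed product as a bilinear map: the extension of convolution. -/
def mulL : R.CP μ →L[𝕜] R.CP μ →L[𝕜] R.CP μ :=
  R.extCP μ
    { toFun := fun f => R.extCP μ (R.q μ ∘ₗ convₗ D μ f) ⟨R.sigma μ f, R.mulL_bound μ f⟩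
      map_add' := fun f g => R.CP_hom_ext μ fun k => by
        rw [_root_.add_apply, extCP_q, extCP_q, extCP_q]
        simp only [LinearMap.comp_apply, map_add, LinearMap.add_apply]
      map_smul' := fun a f => R.CP_hom_ext μ fun k => by
        rw [_root_.smul_apply, extCP_q, extCP_q]
        simp only [LinearMap.comp_apply, map_smul, LinearMap.smul_apply, RingHom.id_apply] }
    ⟨1, fun f => by
      rw [one_mul]
      refine ContinuousLinearMap.opNorm_le_bound _ (apply_nonneg _ _) fun c => ?_
      refine R.CP_induction μ (isClosed_le (ContinuousLinearMap.continuous _).norm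
        (continuous_const.mul continuous_norm)) (fun k => ?_) c
      rw [LinearMap.coe_mk, AddHom.coe_mk, extCP_q]
      change _ ≤ R.sigma μ f * ‖R.q μ k‖
      rw [norm_q]
      exact R.mulL_bound μ f k⟩

lemma mulL_q (f g : C_c(G, A)) : R.mulL μ (R.q μ f) (R.q μ g) = R.q μ (D.conv μ f g) := by
  rw [mulL, extCP_q, LinearMap.coe_mk, AddHom.coe_mk, extCP_q]
  rfl

/-- The crossed product is a Banach algebra. -/
instance : NonUnitalNormedRing (R.CP μ) :=
  { (inferInstance : NormedAddCommGroup (R.CP μ)) with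
    mul := fun a b => R.mulL μ a b
    left_distrib := fun a b c => map_add (R.mulL μ a) b c
    right_distrib := fun a b c => by
      change R.mulL μ (a + b) c = _
      rw [map_add]; rfl
    zero_mul := fun a => by
      change R.mulL μ 0 a = 0
      simp
    mul_zero := fun a => map_zero (R.mulL μ a)
    mul_assoc := fun a b c => by
      change R.mulL μ (R.mulL μ a b) c = R.mulL μ a (R.mulL μ b c)
      have h1 : Continuous fun p : R.CP μ × R.CP μ => R.mulL μ p.1 p.2 :=
        (R.mulL μ).continuous.fst'.clm_apply continuous_snd
      have h2 : ∀ b' c' : R.CP μ, Continuous fun a' => R.mulL μ a' b' := fun b' _ =>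
        h1.comp (f := fun a' => (a', b')) (by fun_prop)
      refine R.CP_induction μ (isClosed_eq ((h2 c c).comp (h2 b b)) (h2 _ c)) (fun f => ?_) a
      refine R.CP_induction μ (isClosed_eq ((h2 c c).comp (R.mulL μ _).continuous)
        ((R.mulL μ _).continuous.comp (h2 c c))) (fun g => ?_) b
      refine R.CP_induction μ (isClosed_eq (R.mulL μ _).continuous
        ((R.mulL μ _).continuous.comp (R.mulL μ _).continuous)) (fun k => ?_) c
      change R.mulL μ (R.mulL μ (R.q μ f) (R.q μ g)) (R.q μ k)
        = R.mulL μ (R.q μ f) (R.mulL μ (R.q μ g) (R.q μ k))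
      simp only [mulL_q]
      exact R.q_eq_of_integrated_eq μ fun ρ => by
        simp only [CovRep.integrated_conv, mul_assoc]
    norm_mul_le := fun a b => by
      change ‖R.mulL μ a b‖ ≤ _
      have h1 : Continuous fun p : R.CP μ × R.CP μ => R.mulL μ p.1 p.2 :=
        (R.mulL μ).continuous.fst'.clm_apply continuous_snd
      refine R.CP_induction μ (isClosed_le
        (h1.comp (f := fun a' => (a', b)) (by fun_prop)).norm
        (continuous_norm.mul continuous_const)) (fun f => ?_) a
      refine R.CP_induction μ (isClosed_le (R.mulL μ _).continuous.norm
        (continuous_const.mul continuous_norm)) (fun g => ?_) b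
      change _ ≤ ‖R.q μ f‖ * ‖R.q μ g‖
      rw [mulL_q]
      simpa only [norm_q] using R.sigma_conv_le μ f g }

lemma mul_def (a b : R.CP μ) : a * b = R.mulL μ a b := rfl

lemma q_mul_q (f g : C_c(G, A)) : R.q μ f * R.q μ g = R.q μ (D.conv μ f g) := R.mulL_q μ f g

instance : IsScalarTower 𝕜 (R.CP μ) (R.CP μ) :=
  ⟨fun c a b => by simp [mul_def]⟩

instance : SMulCommClass 𝕜 (R.CP μ) (R.CP μ) :=
  ⟨fun c a b => by simp [mul_def]⟩

end RepClass

/-! ### Left centralizers -/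

section Centralizer

variable (𝕜 B : Type*) [RCLike 𝕜] [NonUnitalNormedRing B] [NormedSpace 𝕜 B]
  [IsScalarTower 𝕜 B B] [SMulCommClass 𝕜 B B]

/-- The unital normed algebra of left centralizers of `B`. -/
def leftCentralizers : Subalgebra 𝕜 (B →L[𝕜] B) where
  carrier := {L | ∀ a b, L (a * b) = L a * b}
  mul_mem' := fun {L M} hL hM a b => by
    change L (M (a * b)) = L (M a) * b
    rw [hM, hL]
  add_mem' := fun {L M} hL hM a b => by
    change L (a * b) + M (a * b) = (L a + M a) * b
    rw [hL, hM, add_mul]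
  algebraMap_mem' := fun c a b => by
    change c • (a * b) = (c • a) * b
    rw [smul_mul_assoc]

variable {B}

/-- The left centralizer `b' ↦ b * b'`. -/
def leftMul (b : B) : leftCentralizers 𝕜 B :=
  ⟨ContinuousLinearMap.mul 𝕜 B b, fun _ _ => (mul_assoc _ _ _).symm⟩

end Centralizer

/-! ### The canonical maps into the left centralizers of the crossed product -/

variable [IsScalarTower 𝕜 A A] [SMulCommClass 𝕜 A A]

/-- `[i_A(a) f](s) = a f(s)`. -/
def iAfun (𝕜 : Type*) {A G : Type*} [RCLike 𝕜] [NonUnitalNormedRing A] [NormedSpace 𝕜 A]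
    [TopologicalSpace G] [SMulCommClass 𝕜 A A] (a : A) : C_c(G, A) →ₗ[𝕜] C_c(G, A) where
  toFun f :=
    { toFun := fun s => a * f s
      continuous_toFun := by fun_prop
      hasCompactSupport' := f.hasCompactSupport.mono fun s hs hf => hs (by simp [hf]) }
  map_add' f g := by ext s; exact mul_add _ _ _
  map_smul' c f := by ext s; exact mul_smul_comm _ _ _

/-- `[i_G(r) f](s) = α_r(f(r⁻¹ s))`. -/
def iGfun (D : DynSys 𝕜 A G) (r : G) : C_c(G, A) →ₗ[𝕜] C_c(G, A) where
  toFun f :=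
    { toFun := fun s => D.act r (f (r⁻¹ * s))
      continuous_toFun := by fun_prop
      hasCompactSupport' := by
        have := f.hasCompactSupport.comp_homeomorph (Homeomorph.mulLeft r⁻¹)
        exact this.mono fun s hs hf => hs (by
          simp only [Function.comp_apply, Homeomorph.coe_mulLeft] at hf
          simp [hf]) }
  map_add' f g := by ext s; exact map_add (D.act r) _ _
  map_smul' c f := by ext s; exact map_smul (D.act r) _ _

lemma iAfun_apply (a : A) (f : C_c(G, A)) (s : G) : iAfun 𝕜 a f s = a * f s := rfl

lemma iGfun_apply (D : DynSys 𝕜 A G) (r : G) (f : C_c(G, A)) (s : G) :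
    iGfun D r f s = D.act r (f (r⁻¹ * s)) := rfl

namespace CovRep

variable {D : DynSys 𝕜 A G} {X : Type*} [NormedAddCommGroup X] [NormedSpace 𝕜 X]
  [CompleteSpace X]

lemma integrated_iAfun (ρ : CovRep D X) (h : ρ.IsContinuous) (μ : Measure G) [μ.IsHaarMeasure]
    (a : A) (f : C_c(G, A)) :
    ρ.integrated h μ (iAfun 𝕜 a f) = ρ.pi a * ρ.integrated h μ f := by
  ext x
  rw [integrated_apply, mul_apply_eq_comp, integrated_apply,
    ← vint_clm 𝕜 μ _ (ρ.integrable_integrand h μ f x)]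
  simp [iAfun_apply]

lemma integrated_iGfun (ρ : CovRep D X) (h : ρ.IsContinuous) (μ : Measure G) [μ.IsHaarMeasure]
    (r : G) (f : C_c(G, A)) :
    ρ.integrated h μ (iGfun D r f) = ρ.U r * ρ.integrated h μ f := by
  ext x
  rw [integrated_apply, mul_apply_eq_comp, integrated_apply,
    ← vint_clm 𝕜 μ _ (ρ.integrable_integrand h μ f x), ← vint_mul_left 𝕜 μ r]
  simp [iGfun_apply, U_mul_pi]

end CovRep

namespace RepClass

variable {D : DynSys 𝕜 A G} (R : RepClass.{v} D) (μ : Measure G) [μ.IsHaarMeasure]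

lemma sigma_iAfun_le (a : A) : ∃ C : ℝ, ∀ f, R.sigma μ (iAfun 𝕜 a f) ≤ C * R.sigma μ f := by
  obtain ⟨C, ν, -, h⟩ := R.uniformlyBounded
  refine ⟨C * ‖a‖, fun f => R.sigma_le μ fun ρ => ?_⟩
  rw [normAt, CovRep.integrated_iAfun]
  exact (norm_mul_le _ _).trans (mul_le_mul ((h _ ρ.2).1 a) (R.normAt_le_sigma μ f ρ)
    (norm_nonneg _) (by positivity))

lemma sigma_iGfun_le (r : G) : ∃ C : ℝ, ∀ f, R.sigma μ (iGfun D r f) ≤ C * R.sigma μ f := by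
  obtain ⟨C, ν, -, h⟩ := R.uniformlyBounded
  refine ⟨ν r, fun f => R.sigma_le μ fun ρ => ?_⟩
  rw [normAt, CovRep.integrated_iGfun]
  exact (norm_mul_le _ _).trans (mul_le_mul ((h _ ρ.2).2 r) (R.normAt_le_sigma μ f ρ)
    (norm_nonneg _) (by positivity))

/-- The bounded operator on the crossed product induced by a `σ`-bounded operator on
`C_c(G, A)`. -/
def lift (S : C_c(G, A) →ₗ[𝕜] C_c(G, A)) (hS : ∃ C : ℝ, ∀ f, R.sigma μ (S f) ≤ C * R.sigma μ f) :
    R.CP μ →L[𝕜] R.CP μ :=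
  R.extCP μ (R.q μ ∘ₗ S) (by simpa only [LinearMap.comp_apply, norm_q] using hS)

lemma lift_q (S : C_c(G, A) →ₗ[𝕜] C_c(G, A))
    (hS : ∃ C : ℝ, ∀ f, R.sigma μ (S f) ≤ C * R.sigma μ f) (f : C_c(G, A)) :
    R.lift μ S hS (R.q μ f) = R.q μ (S f) := R.extCP_q μ _ _ f

lemma mem_leftCentralizers {L : R.CP μ →L[𝕜] R.CP μ}
    (h : ∀ f g, L (R.q μ f * R.q μ g) = L (R.q μ f) * R.q μ g) :
    L ∈ leftCentralizers 𝕜 (R.CP μ) := by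
  intro a b
  refine R.CP_induction μ (P := fun a => L (a * b) = L a * b)
    (isClosed_eq (by fun_prop) (by fun_prop)) (fun f => ?_) a
  refine R.CP_induction μ (P := fun b => L (R.q μ f * b) = L (R.q μ f) * b)
    (isClosed_eq (by fun_prop) (by fun_prop)) (fun g => h f g) b

/-- The operator `i_A(a)` on the crossed product, determined by `i_A(a) (q f) = q (i_A(a) f)`. -/
def iAelt (a : A) : leftCentralizers 𝕜 (R.CP μ) :=
  ⟨R.lift μ (iAfun 𝕜 a) (R.sigma_iAfun_le μ a), R.mem_leftCentralizers μ fun f g => by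
    rw [q_mul_q, lift_q, lift_q, q_mul_q]
    exact R.q_eq_of_integrated_eq μ fun ρ => by
      simp only [CovRep.integrated_conv, CovRep.integrated_iAfun, mul_assoc]⟩

/-- The operator `i_G(r)` on the crossed product, determined by `i_G(r) (q f) = q (i_G(r) f)`. -/
def iGelt (r : G) : leftCentralizers 𝕜 (R.CP μ) :=
  ⟨R.lift μ (iGfun D r) (R.sigma_iGfun_le μ r), R.mem_leftCentralizers μ fun f g => by
    rw [q_mul_q, lift_q, lift_q, q_mul_q]
    exact R.q_eq_of_integrated_eq μ fun ρ => by
      simp only [CovRep.integrated_conv, CovRep.integrated_iGfun, mul_assoc]⟩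

lemma iAelt_q (a : A) (f : C_c(G, A)) : (R.iAelt μ a).1 (R.q μ f) = R.q μ (iAfun 𝕜 a f) :=
  R.lift_q μ _ (R.sigma_iAfun_le μ a) f

lemma iGelt_q (r : G) (f : C_c(G, A)) : (R.iGelt μ r).1 (R.q μ f) = R.q μ (iGfun D r f) :=
  R.lift_q μ _ (R.sigma_iGfun_le μ r) f

/-- The representation `a ↦ i_A(a)` of `A` on the crossed product, with values in the left
centralizers. -/
def iA : A →ₙₐ[𝕜] leftCentralizers 𝕜 (R.CP μ) where
  toFun := R.iAelt μ
  map_smul' c a := Subtype.ext (R.CP_hom_ext μ fun f => by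
    change (R.iAelt μ (c • a)).1 _ = c • (R.iAelt μ a).1 _
    rw [iAelt_q, iAelt_q, ← map_smul]
    exact congrArg _ (by ext s; exact smul_mul_assoc _ _ _))
  map_zero' := Subtype.ext (R.CP_hom_ext μ fun f => by
    change (R.iAelt μ 0).1 _ = 0
    rw [iAelt_q, ← map_zero (R.q μ)]
    exact congrArg _ (by ext s; exact zero_mul _))
  map_add' a b := Subtype.ext (R.CP_hom_ext μ fun f => by
    change (R.iAelt μ (a + b)).1 _ = (R.iAelt μ a).1 _ + (R.iAelt μ b).1 _
    rw [iAelt_q, iAelt_q, iAelt_q, ← map_add]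
    exact congrArg _ (by ext s; exact add_mul _ _ _))
  map_mul' a b := Subtype.ext (R.CP_hom_ext μ fun f => by
    change (R.iAelt μ (a * b)).1 _ = (R.iAelt μ a).1 ((R.iAelt μ b).1 _)
    rw [iAelt_q, iAelt_q, iAelt_q]
    exact congrArg _ (by ext s; exact mul_assoc _ _ _))

/-- The representation `r ↦ i_G(r)` of `G` on the crossed product, with values in the left
centralizers. -/
def iG : G →* leftCentralizers 𝕜 (R.CP μ) where
  toFun := R.iGelt μ
  map_one' := Subtype.ext (R.CP_hom_ext μ fun f => by
    change (R.iGelt μ 1).1 _ = R.q μ f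
    rw [iGelt_q]
    exact congrArg _ (by ext s; simp [iGfun_apply]))
  map_mul' r t := Subtype.ext (R.CP_hom_ext μ fun f => by
    change (R.iGelt μ (r * t)).1 _ = (R.iGelt μ r).1 ((R.iGelt μ t).1 _)
    rw [iGelt_q, iGelt_q, iGelt_q]
    exact congrArg _ (by ext s; simp [iGfun_apply, mul_assoc]))

lemma iA_q (a : A) (f : C_c(G, A)) : (R.iA μ a).1 (R.q μ f) = R.q μ (iAfun 𝕜 a f) :=
  R.iAelt_q μ a f

lemma iG_q (r : G) (f : C_c(G, A)) : (R.iG μ r).1 (R.q μ f) = R.q μ (iGfun D r f) :=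
  R.iGelt_q μ r f

lemma iA_act (s : G) (a : A) : R.iA μ (D.act s a) = R.iG μ s * R.iA μ a * R.iG μ s⁻¹ :=
  Subtype.ext (R.CP_hom_ext μ fun f => by
    change (R.iA μ (D.act s a)).1 _ = (R.iG μ s).1 ((R.iA μ a).1 ((R.iG μ s⁻¹).1 _))
    rw [iA_q, iG_q, iA_q, iG_q]
    refine congrArg _ ?_
    ext t
    simp only [iGfun_apply, iAfun_apply, D.act_mul]
    congr 1
    have : D.act s (D.act s⁻¹ (f t)) = f t := by
      change (D.act s * D.act s⁻¹) (f t) = f t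
      rw [← map_mul]; simp
    simp [this])

/-- The covariant representation `(T̄ ∘ i_A, T̄ ∘ i_G)`, for a unital homomorphism `T̄` on the
left centralizers of the crossed product. -/
def ofCentralizers {X : Type*} [NormedAddCommGroup X] [NormedSpace 𝕜 X]
    (Tbar : leftCentralizers 𝕜 (R.CP μ) →ₐ[𝕜] (X →L[𝕜] X)) : CovRep D X where
  pi := (Tbar : leftCentralizers 𝕜 (R.CP μ) →ₙₐ[𝕜] (X →L[𝕜] X)).comp (R.iA μ)
  U := (Tbar : leftCentralizers 𝕜 (R.CP μ) →* (X →L[𝕜] X)).comp (R.iG μ)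
  covariant s a := by
    change Tbar (R.iA μ (D.act s a)) = Tbar (R.iG μ s) * Tbar (R.iA μ a) * Tbar (R.iG μ s⁻¹)
    rw [iA_act, map_mul, map_mul]

/-! ### Integration and separation -/

/-- `(π, U)` is continuous and `π ⋊ U` is bounded with respect to `σ`. -/
def IsRContinuous {X : Type*} [NormedAddCommGroup X] [NormedSpace 𝕜 X] [CompleteSpace X]
    (ρ : CovRep D X) : Prop :=
  ∃ h : ρ.IsContinuous, ∃ C : ℝ, ∀ f, ‖ρ.integrated h μ f‖ ≤ C * R.sigma μ f

/-- The representation `(π ⋊ U)^R` of the crossed product, determined by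
`(π ⋊ U)^R (q f) = π ⋊ U (f)`. -/
def integratedRep {X : Type*} [NormedAddCommGroup X] [NormedSpace 𝕜 X] [CompleteSpace X]
    (ρ : CovRep D X) (h : R.IsRContinuous μ ρ) : R.CP μ →ₙₐ[𝕜] (X →L[𝕜] X) where
  toFun := R.extCP μ (ρ.integrated h.1 μ) h.2
  map_smul' := map_smul _
  map_zero' := map_zero _
  map_add' := map_add _
  map_mul' a b := by
    refine R.CP_induction μ (P := fun a => R.extCP μ (ρ.integrated h.1 μ) h.2 (a * b) =
      R.extCP μ (ρ.integrated h.1 μ) h.2 a * R.extCP μ (ρ.integrated h.1 μ) h.2 b)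
      (isClosed_eq (by fun_prop) (by fun_prop)) (fun f => ?_) a
    refine R.CP_induction μ (P := fun b => R.extCP μ (ρ.integrated h.1 μ) h.2 (R.q μ f * b) =
      R.extCP μ (ρ.integrated h.1 μ) h.2 (R.q μ f) * R.extCP μ (ρ.integrated h.1 μ) h.2 b)
      (isClosed_eq (by fun_prop) (by fun_prop)) (fun g => ?_) b
    rw [q_mul_q, extCP_q, extCP_q, extCP_q, CovRep.integrated_conv]

lemma integratedRep_q {X : Type*} [NormedAddCommGroup X] [NormedSpace 𝕜 X] [CompleteSpace X]
    (ρ : CovRep D X) (h : R.IsRContinuous μ ρ) (f : C_c(G, A)) :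
    R.integratedRep μ ρ h (R.q μ f) = ρ.integrated h.1 μ f := R.extCP_q μ _ _ f

/-- The homomorphism `T̄` on the left centralizers of the crossed product extends the
representation `T` of the crossed product, i.e. `T̄ (leftMul c) = T c` for all `c`. -/
def Extends {X : Type*} [NormedAddCommGroup X] [NormedSpace 𝕜 X]
    (Tbar : leftCentralizers 𝕜 (R.CP μ) →ₙₐ[𝕜] (X →L[𝕜] X)) (T : R.CP μ →ₙₐ[𝕜] (X →L[𝕜] X)) :
    Prop :=
  ∀ c, Tbar (leftMul 𝕜 c) = T c

open scoped Classical in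
/-- Integration: `(π, U) ↦ (π ⋊ U)^R` for `R`-continuous `(π, U)`. (On other covariant
representations, where the map is not defined, it takes the value `0`.) -/
def integration (ρ : Σ X : BanachSp.{_, w} 𝕜, CovRep D X) :
    Σ X : BanachSp.{_, w} 𝕜, (R.CP μ →ₙₐ[𝕜] (X →L[𝕜] X)) :=
  ⟨ρ.1, if h : R.IsRContinuous μ ρ.2 then R.integratedRep μ ρ.2 h else 0⟩

open scoped Classical in
/-- The covariant representation `(T̄ ∘ i_A, T̄ ∘ i_G)`, where `T̄` is a unital homomorphism on the
left centralizers of the crossed product that extends `T`. (If there is no such `T̄`, it is the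
pair `(0, 1)`.) -/
def separatedRep {X : Type*} [NormedAddCommGroup X] [NormedSpace 𝕜 X]
    (T : R.CP μ →ₙₐ[𝕜] (X →L[𝕜] X)) : CovRep D X :=
  if h : ∃ Tbar : leftCentralizers 𝕜 (R.CP μ) →ₐ[𝕜] (X →L[𝕜] X),
    R.Extends μ (Tbar : leftCentralizers 𝕜 (R.CP μ) →ₙₐ[𝕜] (X →L[𝕜] X)) T
    then R.ofCentralizers μ h.choose else CovRep.trivial D X

/-- Separation: `T ↦ (T̄ ∘ i_A, T̄ ∘ i_G)`. -/
def separation (T : Σ X : BanachSp.{_, w} 𝕜, (R.CP μ →ₙₐ[𝕜] (X →L[𝕜] X))) :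
    Σ X : BanachSp.{_, w} 𝕜, CovRep D X :=
  ⟨T.1, R.separatedRep μ T.2⟩

/-- The non-degenerate `R`-continuous covariant representations in spaces from `𝓧`. -/
def covRepSet (𝓧 : Set (BanachSp.{_, w} 𝕜)) : Set (Σ X : BanachSp.{_, w} 𝕜, CovRep D X) :=
  {ρ | ρ.1 ∈ 𝓧 ∧ ρ.2.IsNondeg ∧ R.IsRContinuous μ ρ.2}

/-- The non-degenerate bounded representations of the crossed product in spaces from `𝓧`. -/
def repSet (𝓧 : Set (BanachSp.{_, w} 𝕜)) :
    Set (Σ X : BanachSp.{_, w} 𝕜, (R.CP μ →ₙₐ[𝕜] (X →L[𝕜] X))) :=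
  {T | T.1 ∈ 𝓧 ∧ IsNondegRep T.2 ∧ IsBddRep T.2}

end RepClass

end System

/-! ### The involutive case -/

section Modular

variable {G : Type*} [Group G] [TopologicalSpace G] [IsTopologicalGroup G]
  [LocallyCompactSpace G]

/-- The modular function `Δ` of `G`, normalised by `Δ(r) ∫ f(s r) ds = ∫ f(s) ds`; it is the
inverse of the modular character of Mathlib. -/
def modular (r : G) : ℝ := ((Measure.modularCharacter r : ℝ≥0) : ℝ)⁻¹

lemma modular_pos (r : G) : 0 < modular r :=
  inv_pos.2 (Measure.modularCharacterFun_pos r)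

lemma modular_inv (r : G) : modular r⁻¹ = (modular r)⁻¹ := by simp [modular]

lemma modular_mul_integral [MeasurableSpace G] [BorelSpace G] (μ : Measure G)
    [μ.IsHaarMeasure] (r : G) {f : G → ℝ} (hf : Continuous f) (h'f : HasCompactSupport f) :
    modular r * ∫ s, f (s * r) ∂μ = ∫ s, f s ∂μ := by
  have h1 : ∫ s, f (s * r) ∂μ = ∫ s, f s ∂(μ.map (· * r)) := by
    rw [integral_map (by fun_prop) hf.aestronglyMeasurable]
  have h2 : ∫ s, f s ∂(μ.map (· * r)) = Measure.modularCharacter r • ∫ s, f s ∂μ := by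
    rw [Measure.integral_isMulLeftInvariant_eq_smul_of_hasCompactSupport (μ.map (· * r)) μ hf h'f,
      integral_smul_nnreal_measure]
    congr 1
    exact (Measure.modularCharacterFun_eq_haarScalarFactor μ r).symm
  have h3 : ((Measure.modularCharacter r : ℝ≥0) : ℝ) ≠ 0 :=
    (NNReal.coe_pos.2 (Measure.modularCharacterFun_pos r)).ne'
  rw [h1, h2, modular, NNReal.smul_def, smul_eq_mul, inv_mul_cancel_left₀ h3]

lemma continuous_modular : Continuous (modular : G → ℝ) := by
  borelize G
  let μ : Measure G := Measure.haar
  obtain ⟨⟨f, hf⟩, h'f, hf0, hf1⟩ :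
    ∃ f : C(G, ℝ), HasCompactSupport f ∧ 0 ≤ f ∧ f 1 ≠ 0 := exists_continuous_nonneg_pos 1
  simp only [ContinuousMap.coe_mk] at h'f hf1
  have hpos : 0 < ∫ s, f s ∂μ := hf.integral_pos_of_hasCompactSupport_nonneg_nonzero h'f hf0 hf1
  have hI : Continuous fun r : G => ∫ s, f (s * r) ∂μ := by
    rw [continuous_iff_continuousAt]
    intro r
    obtain ⟨K, hK, hKr⟩ := exists_compact_mem_nhds r
    have : ContinuousOn (fun r : G => ∫ s, f (s * r) ∂μ) K := by
      refine continuousOn_integral_of_compact_support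
        (k := (fun p : G × G => p.1 * p.2⁻¹) '' (tsupport f ×ˢ K))
        ((h'f.isCompact.prod hK).image (by fun_prop)) (Continuous.continuousOn (by
          simp only [Function.uncurry_def]; fun_prop)) ?_
      intro p s hp hs
      refine image_eq_zero_of_notMem_tsupport fun h => hs ?_
      exact ⟨(s * p, p), ⟨h, hp⟩, by simp⟩
    exact this.continuousAt hKr
  have h0 : ∀ r : G, ∫ s, f (s * r) ∂μ ≠ 0 := by
    intro r h
    have := modular_mul_integral μ r hf h'f
    rw [h, mul_zero] at this
    exact hpos.ne this
  have : (modular : G → ℝ) = fun r => (∫ s, f s ∂μ) / ∫ s, f (s * r) ∂μ := by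
    ext r
    rw [eq_div_iff (h0 r)]
    exact modular_mul_integral μ r hf h'f
  rw [this]
  exact continuous_const.div hI h0

lemma integral_modular_inv [MeasurableSpace G] [BorelSpace G] (μ : Measure G)
    [μ.IsHaarMeasure] {f : G → ℝ} (hf : Continuous f) (h'f : HasCompactSupport f) :
    ∫ s, modular s⁻¹ * f s⁻¹ ∂μ = ∫ s, f s ∂μ := by
  obtain ⟨⟨g, hg⟩, h'g, hg0, hg1⟩ :
    ∃ f : C(G, ℝ), HasCompactSupport f ∧ 0 ≤ f ∧ f 1 ≠ 0 := exists_continuous_nonneg_pos 1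
  simp only [ContinuousMap.coe_mk] at h'g hg1
  have hpos : 0 < ∫ s, g s ∂μ := hg.integral_pos_of_hasCompactSupport_nonneg_nonzero h'g hg0 hg1
  have hinv : ∀ φ : G → ℝ, ∫ s, φ s ∂μ.inv = ∫ s, φ s⁻¹ ∂μ := fun φ =>
    integral_map_equiv (MeasurableEquiv.inv G) φ
  rw [Measure.integral_isMulLeftInvariant_isMulRightInvariant_combo (μ := μ) (ν := μ.inv)
    hf h'f hg h'g hg0 hg1, hinv, ← integral_mul_const]
  congr 1
  ext s
  rw [hinv]
  simp only [inv_inv]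
  have := modular_mul_integral μ s⁻¹ hg h'g
  have h2 := modular_pos s⁻¹
  have h3 : ∫ t, g (t * s⁻¹) ∂μ ≠ 0 := by
    intro h
    rw [h, mul_zero] at this
    exact hpos.ne this
  rw [← this]
  field_simp

lemma vint_modular_inv [MeasurableSpace G] [BorelSpace G] (μ : Measure G)
    [μ.IsHaarMeasure] {E : Type*} (𝕜 : Type*) [RCLike 𝕜] [NormedAddCommGroup E]
    [NormedSpace 𝕜 E] [CompleteSpace E] {f : G → E} (hf : Continuous f)
    (h'f : HasCompactSupport f) :
    vint 𝕜 μ (fun s => (modular s⁻¹ : 𝕜) • f s⁻¹) = vint 𝕜 μ f := by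
  let : NormedSpace ℝ E := NormedSpace.restrictScalars ℝ 𝕜 E
  have hs : ∀ s, (modular s⁻¹ : 𝕜) • f s⁻¹ = modular s⁻¹ • f s⁻¹ := by
    intro s
    change _ = (algebraMap ℝ 𝕜 (modular s⁻¹)) • f s⁻¹
    rfl
  change ∫ s, (modular s⁻¹ : 𝕜) • f s⁻¹ ∂μ = ∫ s, f s ∂μ
  simp only [hs]
  have hc : HasCompactSupport fun s => modular s⁻¹ • f s⁻¹ :=
    (h'f.comp_homeomorph (Homeomorph.inv G)).smul_left
  have hc' : Continuous fun s => modular s⁻¹ • f s⁻¹ := by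
    have := continuous_modular (G := G)
    fun_prop
  refine (SeparatingDual.eq_iff_forall_dual_eq (R := ℝ)).2 fun ℓ => ?_
  rw [← ℓ.integral_comp_comm (hc'.integrable_of_hasCompactSupport hc),
    ← ℓ.integral_comp_comm (hf.integrable_of_hasCompactSupport h'f)]
  simp only [map_smul, smul_eq_mul]
  exact integral_modular_inv μ (ℓ.continuous.comp hf) (h'f.comp_left (map_zero ℓ))

end Modular

lemma vint_conj {G 𝕜 : Type*} [RCLike 𝕜] [MeasurableSpace G] (μ : Measure G) {f : G → 𝕜}
    (hf : Integrable f μ) :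
    vint 𝕜 μ (fun s => starRingEnd 𝕜 (f s)) = starRingEnd 𝕜 (vint 𝕜 μ f) := by
  let : NormedSpace ℝ 𝕜 := NormedSpace.restrictScalars ℝ 𝕜 𝕜
  let L : 𝕜 →L[ℝ] 𝕜 :=
    { toFun := starRingEnd 𝕜
      map_add' := map_add _
      map_smul' := fun r z => by
        change starRingEnd 𝕜 ((r : 𝕜) * z) = (r : 𝕜) * starRingEnd 𝕜 z
        rw [map_mul, RCLike.conj_ofReal]
      cont := RCLike.continuous_conj }
  exact L.integral_comp_comm hf

section Involutive

variable {𝕜 A G : Type*} [RCLike 𝕜] [NonUnitalNormedRing A] [NormedSpace 𝕜 A]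
  [StarRing A] [StarModule 𝕜 A] [Group G] [TopologicalSpace G]

/-- The system is involutive: the involution of `A` is bounded, and all `α_s` are involutive. -/
structure DynSys.IsInvolutive (D : DynSys 𝕜 A G) : Prop where
  bounded : ∃ C : ℝ, ∀ a : A, ‖star a‖ ≤ C * ‖a‖
  act_star : ∀ (s : G) (a : A), D.act s (star a) = star (D.act s a)

lemma DynSys.IsInvolutive.continuous_star {D : DynSys 𝕜 A G} (hD : D.IsInvolutive) :
    Continuous (star : A → A) := by
  obtain ⟨C, hC⟩ := hD.bounded
  exact AddMonoidHomClass.continuous_of_bound (starAddEquiv (R := A)) C hC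

variable [IsTopologicalGroup G] [LocallyCompactSpace G] [CompleteSpace A]

/-- The involution `f^*(s) = Δ(s⁻¹) α_s(f(s⁻¹)^*)` of `C_c(G, A)`. -/
def DynSys.invol (D : DynSys 𝕜 A G) (hD : D.IsInvolutive) (f : C_c(G, A)) : C_c(G, A) where
  toFun s := (modular s⁻¹ : 𝕜) • D.act s (star (f s⁻¹))
  continuous_toFun := by
    have h1 : Continuous fun s => D.act s (star (f s⁻¹)) :=
      D.continuous_uncurry.comp (f := fun s => (s, star (f s⁻¹)))
        (continuous_id.prodMk (hD.continuous_star.comp (by fun_prop)))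
    have h2 : Continuous fun s : G => (modular s⁻¹ : 𝕜) :=
      RCLike.continuous_ofReal.comp (continuous_modular.comp continuous_inv)
    exact h2.smul h1
  hasCompactSupport' := by
    refine (f.hasCompactSupport.comp_homeomorph (Homeomorph.inv G)).mono fun s hs hf => hs ?_
    simp only [Function.comp_apply, Homeomorph.coe_inv] at hf
    simp [hf]

lemma DynSys.invol_apply (D : DynSys 𝕜 A G) (hD : D.IsInvolutive) (f : C_c(G, A)) (s : G) :
    D.invol hD f s = (modular s⁻¹ : 𝕜) • D.act s (star (f s⁻¹)) := rfl

lemma DynSys.invol_sub (D : DynSys 𝕜 A G) (hD : D.IsInvolutive) (f g : C_c(G, A)) :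
    D.invol hD (f - g) = D.invol hD f - D.invol hD g := by
  ext s
  simp [DynSys.invol_apply, smul_sub]

variable [MeasurableSpace G] [BorelSpace G]

/-- The integrated form of an involutive covariant representation is involutive. -/
lemma CovRep.inner_integrated_invol {D : DynSys 𝕜 A G} (hD : D.IsInvolutive)
    {X : Type*} [NormedAddCommGroup X]
    [NormedSpace 𝕜 X] [CompleteSpace X] (ρ : CovRep D X) (h : ρ.IsContinuous) (μ : Measure G)
    [μ.IsHaarMeasure] (c : InnerProductSpace.Core 𝕜 X) (hc : IsHilbertCore c)
    (hpi : ∀ a x y, c.inner (ρ.pi (star a) x) y = c.inner x (ρ.pi a y))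
    (hU : ∀ s x y, c.inner (ρ.U s x) (ρ.U s y) = c.inner x y) (f : C_c(G, A)) (x y : X) :
    c.inner (ρ.integrated h μ (D.invol hD f) x) y = c.inner x (ρ.integrated h μ f y) := by
  let ip : InnerProductSpace 𝕜 X :=
    { (inferInstance : NormedSpace 𝕜 X), c with
      norm_sq_eq_re_inner := fun x => (hc x).symm
      conj_inner_symm := c.conj_inner_symm
      add_left := c.add_left
      smul_left := c.smul_left }
  change inner 𝕜 (ρ.integrated h μ (D.invol hD f) x) y = inner 𝕜 x (ρ.integrated h μ f y)
  change ∀ a x y, inner 𝕜 (ρ.pi (star a) x) y = inner 𝕜 x (ρ.pi a y) at hpi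
  change ∀ s x y, inner 𝕜 (ρ.U s x) (ρ.U s y) = inner 𝕜 x y at hU
  rw [← inner_conj_symm, CovRep.integrated_apply, CovRep.integrated_apply]
  have e1 := vint_clm 𝕜 μ (innerSL 𝕜 y) (ρ.integrable_integrand h μ (D.invol hD f) x)
  have e2 := vint_clm 𝕜 μ (innerSL 𝕜 x) (ρ.integrable_integrand h μ f y)
  simp only [innerSL_apply_apply] at e1 e2
  rw [← e1, ← e2]
  have hcont : Continuous fun s => inner 𝕜 x (ρ.pi (f s) (ρ.U s y)) :=
    (innerSL 𝕜 x).continuous.comp (ρ.continuous_integrand h f y)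
  have hsupp : HasCompactSupport fun s => inner 𝕜 x (ρ.pi (f s) (ρ.U s y)) :=
    (ρ.hasCompactSupport_integrand f y).comp_left (g := fun z => inner 𝕜 x z) (by simp)
  rw [← vint_modular_inv μ 𝕜 hcont hsupp]
  have hpt : ∀ s, inner 𝕜 y (ρ.pi (D.invol hD f s) (ρ.U s x))
      = starRingEnd 𝕜 ((modular s⁻¹ : 𝕜) • inner 𝕜 x (ρ.pi (f s⁻¹) (ρ.U s⁻¹ y))) := by
    intro s
    have h1 : y = ρ.U s (ρ.U s⁻¹ y) := by rw [← CovRep.U_mul_apply]; simp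
    rw [DynSys.invol_apply, map_smul, _root_.smul_apply, inner_smul_right, ← CovRep.U_mul_pi,
      smul_eq_mul, map_mul, RCLike.conj_ofReal, inner_conj_symm]
    congr 1
    conv_lhs => rw [h1]
    rw [hU, ← inner_conj_symm, hpi, inner_conj_symm]
  simp only [hpt]
  have hint : Integrable (fun s => (modular s⁻¹ : 𝕜) • inner 𝕜 x (ρ.pi (f s⁻¹) (ρ.U s⁻¹ y))) μ := by
    have h2 : Continuous fun s : G => (modular s⁻¹ : 𝕜) :=
      RCLike.continuous_ofReal.comp (continuous_modular.comp continuous_inv)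
    refine (h2.smul (hcont.comp continuous_inv)).integrable_of_hasCompactSupport ?_
    exact (hsupp.comp_homeomorph (Homeomorph.inv G)).smul_left
  rw [vint_conj μ hint, RCLike.conj_conj]

/-- For involutive `(π, U)`, the seminorm `f ↦ ‖π ⋊ U (f)‖` is invariant under the involution. -/
lemma CovRep.IsInvolutive.norm_integrated_invol {D : DynSys 𝕜 A G} (hD : D.IsInvolutive)
    {X : Type*} [NormedAddCommGroup X] [NormedSpace 𝕜 X] [CompleteSpace X] {ρ : CovRep D X}
    (hρ : ρ.IsInvolutive) (h : ρ.IsContinuous) (μ : Measure G) [μ.IsHaarMeasure]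
    (f : C_c(G, A)) :
    ‖ρ.integrated h μ (D.invol hD f)‖ = ‖ρ.integrated h μ f‖ := by
  obtain ⟨c, hc, hpi, hU⟩ := hρ
  have key := ρ.inner_integrated_invol hD h μ c hc hpi hU f
  let ip : InnerProductSpace 𝕜 X :=
    { (inferInstance : NormedSpace 𝕜 X), c with
      norm_sq_eq_re_inner := fun x => (hc x).symm
      conj_inner_symm := c.conj_inner_symm
      add_left := c.add_left
      smul_left := c.smul_left }
  have : ρ.integrated h μ (D.invol hD f) = ContinuousLinearMap.adjoint (ρ.integrated h μ f) :=
    (ContinuousLinearMap.eq_adjoint_iff _ _).2 key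
  rw [this]
  exact (ContinuousLinearMap.adjoint (𝕜 := 𝕜) (E := X) (F := X)).norm_map _

namespace RepClass

variable [IsScalarTower 𝕜 A A] [SMulCommClass 𝕜 A A] {D : DynSys 𝕜 A G} (R : RepClass.{v} D)
  (μ : Measure G) [μ.IsHaarMeasure]

/-- All elements of the class are involutive. -/
def IsInvolutive : Prop := ∀ ρ ∈ R.carrier, ρ.2.IsInvolutive

/-- The involution of the crossed product when the system and the class are involutive: the
continuous extension of the involution of `C_c(G, A)`. -/
def cpStar (hD : D.IsInvolutive) : R.CP μ → R.CP μ :=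
  UniformSpace.Completion.map fun f => R.toPre μ (D.invol hD ((R.toPre μ).symm f))

lemma isometry_invol (hD : D.IsInvolutive) (hR : R.IsInvolutive) :
    Isometry fun f => R.toPre μ (D.invol hD ((R.toPre μ).symm f)) := by
  refine Isometry.of_dist_eq fun f g => ?_
  rw [dist_eq_norm, dist_eq_norm, ← map_sub, ← DynSys.invol_sub, ← map_sub, norm_toPre]
  change _ = R.sigma μ ((R.toPre μ).symm (f - g))
  rw [sigma_apply, sigma_apply]
  congr 1
  ext ρ
  exact (hR _ ρ.2).norm_integrated_invol hD _ μ _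

/-- In the involutive case, the involution of the crossed product is continuous and extends the
involution of `C_c(G, A)`. -/
lemma continuous_cpStar (hD : D.IsInvolutive) : Continuous (R.cpStar μ hD) :=
  UniformSpace.Completion.continuous_map

lemma cpStar_q (hD : D.IsInvolutive) (hR : R.IsInvolutive) (f : C_c(G, A)) :
    R.cpStar μ hD (R.q μ f) = R.q μ (D.invol hD f) :=
  UniformSpace.Completion.map_coe (R.isometry_invol μ hD hR).uniformContinuous _

end RepClass

end Involutive

end
end CrossedProd

open CrossedProd MeasureTheory

universe u𝕜 uA uG v w

namespace CrossedProd

noncomputable section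

set_option linter.unusedSectionVars false

/-! ### Extension of non-degenerate representations to left centralizers -/

section Extension

variable {𝕜 B X Y ι : Type*} [RCLike 𝕜] [NonUnitalNormedRing B] [NormedSpace 𝕜 B]
  [NormedAddCommGroup X] [NormedSpace 𝕜 X] [NormedAddCommGroup Y] [NormedSpace 𝕜 Y]

/-! Everything rests on two facts: the crossed product `B` inherits a bounded approximate left
identity from `A`, and a non-degenerate bounded representation `T` of an algebra with such an
identity `e` extends to the left centralizers by `T̄(L) x = lim T(L e_i) x`.

For the extension (`IsBddApproxLeftId.exists_extension`), the limit exists on vectors `T b x`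
because `T(L e_i) T(b) x = T(L(e_i b)) x → T(L b) x`, and uniform boundedness carries this to all of
`X`. The resulting formula `T̄(L) T(b) x = T(L b) x` determines `T̄(L)` by density, which yields at
once linearity, multiplicativity, unitality and uniqueness (`RepClass.extends_unique`).

For the approximate identity (`RepClass.exists_isBddApproxLeftId`), the pair `(i_A, i_G)` is viewed
as a continuous covariant representation on `B` itself. Its integrated form is left multiplication
(`RepClass.leftRegular_integrated_apply`): this is tested through the representations in the class,
which separate the points of `B`. If `z` is a normalised bump function near the identity of `G`,
then `q(z ⊗ e_i) c` equals `i_A(e_i)` applied to the average `∫ z(s) i_G(s) c ds`, which is close to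
`c`.

With `(π, U) = (T̄ ∘ i_A, T̄ ∘ i_G)`, applying `T` to the integral formula `∫ i_A(f(s)) i_G(s) c ds
= q(f) c` shows that `π ⋊ U` is `T` again (`RepClass.integrated_separatedRep`). Conversely, an
integrated form satisfies `T(i_A(a) c) = π(a) T(c)` and `T(i_G(r) c) = U_r T(c)`, so that `(π, U)`
is recovered on the vectors `T(c) x` (`RepClass.separatedRep_integratedRep`). The same two
identities, used along an approximate identity, transfer closed invariant subspaces and intertwining
operators. In the involutive case they combine with the adjoint relations for `i_A` and `i_G` in `B`
(`RepClass.cpStar_iA_mul`, `RepClass.cpStar_iG_mul`). -/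

/-- The net `e` along the filter `l` is a bounded approximate left identity. -/
structure IsBddApproxLeftId (l : Filter ι) (e : ι → B) : Prop where
  bounded : ∃ M : ℝ, ∀ i, ‖e i‖ ≤ M
  tendsto_mul : ∀ b, Tendsto (fun i => e i * b) l (𝓝 b)

/-- A bounded representation as a bounded operator. -/
def IsBddRep.toCLM {T : B →ₙₐ[𝕜] (X →L[𝕜] X)} (hT : IsBddRep T) : B →L[𝕜] (X →L[𝕜] X) :=
  LinearMap.mkContinuousOfExistsBound (T : B →ₗ[𝕜] (X →L[𝕜] X)) hT

@[simp] lemma IsBddRep.toCLM_apply {T : B →ₙₐ[𝕜] (X →L[𝕜] X)} (hT : IsBddRep T) (b : B) :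
    hT.toCLM b = T b := rfl

lemma IsBddRep.continuous_apply {T : B →ₙₐ[𝕜] (X →L[𝕜] X)} (hT : IsBddRep T) (x : X) :
    Continuous fun b => T b x :=
  hT.toCLM.continuous.clm_apply continuous_const

lemma rep_mul_apply (T : B →ₙₐ[𝕜] (X →L[𝕜] X)) (b c : B) (x : X) :
    T (b * c) x = T b (T c x) := by
  rw [map_mul]; rfl

/-- A net of uniformly bounded operators that converges to a bounded operator on a set with dense
span converges to it everywhere. -/
lemma tendsto_apply_of_dense_span {l : Filter ι} {S : ι → X →L[𝕜] Y} {S₀ : X →L[𝕜] Y} {M : ℝ}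
    (hM : ∀ᶠ i in l, ‖S i‖ ≤ M) {s : Set X} (hs : Dense (Submodule.span 𝕜 s : Set X))
    (h : ∀ x ∈ s, Tendsto (fun i => S i x) l (𝓝 (S₀ x))) (x : X) :
    Tendsto (fun i => S i x) l (𝓝 (S₀ x)) := by
  have hspan : ∀ y ∈ Submodule.span 𝕜 s, Tendsto (fun i => S i y) l (𝓝 (S₀ y)) := by
    intro y hy
    induction hy using Submodule.span_induction with
    | mem y hy => exact h y hy
    | zero => simpa using tendsto_const_nhds
    | add y z _ _ hy hz => simpa using hy.add hz
    | smul c y _ hy => simpa using hy.const_smul c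
  rw [Metric.tendsto_nhds]
  intro ε hε
  -- The operators `S i - S₀` have norm at most `|M| + ‖S₀‖ + 1`, so that this radius costs at most
  -- `ε / 2`. The summand 1 keeps the denominator positive.
  obtain ⟨y, hxy, hy⟩ := Metric.dense_iff.1 hs x (ε / (2 * (|M| + ‖S₀‖ + 1))) (by positivity)
  rw [Metric.mem_ball, dist_eq_norm] at hxy
  filter_upwards [hM, Metric.tendsto_nhds.1 (hspan y hy) (ε / 2) (by positivity)] with i hi h2
  rw [dist_eq_norm] at h2 ⊢
  have e1 : S i x - S₀ x = (S i y - S₀ y) - (S i - S₀) (y - x) := by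
    simp only [map_sub, _root_.sub_apply]; abel
  have h3 : ‖S i - S₀‖ ≤ |M| + ‖S₀‖ + 1 :=
    (norm_sub_le _ _).trans (by linarith [le_abs_self M])
  have h4 : ‖(S i - S₀) (y - x)‖ ≤ (|M| + ‖S₀‖ + 1) * ‖y - x‖ :=
    (S i - S₀).le_of_opNorm_le h3 _
  have h5 : (|M| + ‖S₀‖ + 1) * ‖y - x‖ < ε / 2 := by
    have hp : 0 < |M| + ‖S₀‖ + 1 := by positivity
    calc _ < (|M| + ‖S₀‖ + 1) * (ε / (2 * (|M| + ‖S₀‖ + 1))) := by gcongr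
      _ = ε / 2 := by field_simp
  rw [e1]
  linarith [norm_sub_le (S i y - S₀ y) ((S i - S₀) (y - x))]

section Net

variable {l : Filter ι} {e : ι → B} {T : B →ₙₐ[𝕜] (X →L[𝕜] X)}

/-- On a vector `T b y` this is `T (e i * b) y → T b y`; uniform boundedness of the `T (e i)` and
non-degeneracy do the rest. -/
lemma IsBddApproxLeftId.tendsto_rep (he : IsBddApproxLeftId l e) (hT : IsBddRep T)
    (hn : IsNondegRep T) (x : X) : Tendsto (fun i => T (e i) x) l (𝓝 x) := by
  obtain ⟨M, hM⟩ := he.bounded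
  have hb : ∀ i, ‖T (e i)‖ ≤ ‖hT.toCLM‖ * M := fun i =>
    (hT.toCLM.le_opNorm (e i)).trans (mul_le_mul_of_nonneg_left (hM i) (norm_nonneg _))
  refine tendsto_apply_of_dense_span (S₀ := ContinuousLinearMap.id 𝕜 X)
    (Eventually.of_forall hb) hn ?_ x
  rintro _ ⟨b, y, rfl⟩
  simp only [← rep_mul_apply]
  exact ((hT.continuous_apply y).tendsto b).comp (he.tendsto_mul b)

/-- A closed property that holds for all `T b x` holds everywhere. -/
lemma IsBddApproxLeftId.rep_induction [l.NeBot] (he : IsBddApproxLeftId l e) (hT : IsBddRep T)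
    (hn : IsNondegRep T) {P : X → Prop} (hP : IsClosed {x | P x}) (h : ∀ b x, P (T b x)) (x : X) :
    P x :=
  -- Each `x` is a limit of single vectors `T (e i) x`, so `P` need not be stable under linear
  -- combinations.
  hP.mem_of_tendsto (he.tendsto_rep hT hn x) (Eventually.of_forall fun i => h (e i) x)

variable [IsScalarTower 𝕜 B B]

lemma leftCentralizers_map_mul (L : leftCentralizers 𝕜 B) (b c : B) :
    L.1 (b * c) = L.1 b * c := L.2 b c

variable [SMulCommClass 𝕜 B B]

lemma mul_leftMul (L : leftCentralizers 𝕜 B) (b : B) : L * leftMul 𝕜 b = leftMul 𝕜 (L.1 b) :=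
  Subtype.ext (ContinuousLinearMap.ext fun c => L.2 b c)

/-- The image of `leftMul` is a left ideal of the centralizers, with `L * leftMul b = leftMul (L
b)`. Hence multiplicativity alone, without any boundedness of `T'`, fixes `T' L` on the range of
`T`. -/
lemma extension_apply {T' : leftCentralizers 𝕜 B →ₙₐ[𝕜] (X →L[𝕜] X)}
    (hT' : ∀ b, T' (leftMul 𝕜 b) = T b) (L : leftCentralizers 𝕜 B) (b : B) (x : X) :
    T' L (T b x) = T (L.1 b) x := by
  rw [← hT', ← hT', ← mul_leftMul, map_mul]; rfl

/-- The net is Cauchy: `x` may be replaced by some `T (e j) x` up to a uniformly small error, and `T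
(L e_i) T (e_j) x = T (L (e_i e_j)) x` converges to `T (L e_j) x`. -/
lemma IsBddApproxLeftId.exists_tendsto [l.NeBot] [CompleteSpace X] (he : IsBddApproxLeftId l e)
    (hT : IsBddRep T) (hn : IsNondegRep T) (L : leftCentralizers 𝕜 B) (x : X) :
    ∃ y, Tendsto (fun i => T (L.1 (e i)) x) l (𝓝 y) := by
  obtain ⟨M, hM⟩ := he.bounded
  have hM0 : 0 ≤ M := by
    obtain ⟨i⟩ := l.nonempty_of_neBot
    exact (norm_nonneg _).trans (hM i)
  set K := ‖hT.toCLM‖ * (‖L‖ * M) with hK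
  have hb : ∀ i, ‖T (L.1 (e i))‖ ≤ K := fun i =>
    (hT.toCLM.le_opNorm _).trans (mul_le_mul_of_nonneg_left
      (L.1.le_of_opNorm_le_of_le le_rfl (hM i)) (norm_nonneg _))
  have hK0 : 0 ≤ K := by positivity
  rw [← cauchy_map_iff_exists_tendsto, Metric.cauchy_iff]
  refine ⟨inferInstance, fun ε hε => ?_⟩
  -- With this tolerance the replacement of `x` by `T (e j) x` costs `ε / 4` under every `T (L
  -- e_i)`; the convergence in `h2` costs another `ε / 4`, so the net is eventually in a ball of
  -- radius `ε / 2`. Here `K + 1` avoids a division by zero.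
  have h1 := Metric.tendsto_nhds.1 (he.tendsto_rep hT hn x) (ε / (4 * (K + 1))) (by positivity)
  obtain ⟨j, hj⟩ := h1.exists
  have h2 : Tendsto (fun i => T (L.1 (e i)) (T (e j) x)) l (𝓝 (T (L.1 (e j)) x)) := by
    simp only [← rep_mul_apply, ← leftCentralizers_map_mul]
    exact ((hT.continuous_apply x).tendsto _).comp ((L.1.continuous.tendsto _).comp
      (he.tendsto_mul (e j)))
  have h3 := Metric.tendsto_nhds.1 h2 (ε / 4) (by positivity)
  have h4 : ∀ᶠ i in l, T (L.1 (e i)) x ∈ Metric.ball (T (L.1 (e j)) x) (ε / 2) := by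
    filter_upwards [h3] with i hi
    rw [Metric.mem_ball]
    refine (dist_triangle _ (T (L.1 (e i)) (T (e j) x)) _).trans_lt ?_
    have : dist (T (L.1 (e i)) x) (T (L.1 (e i)) (T (e j) x)) ≤ ε / 4 := by
      rw [dist_eq_norm, ← map_sub]
      rw [dist_comm, dist_eq_norm] at hj
      calc _ ≤ (K + 1) * (ε / (4 * (K + 1))) :=
            (T (L.1 (e i))).le_of_opNorm_le_of_le ((hb i).trans (by linarith)) hj.le
        _ = ε / 4 := by field_simp
    linarith
  refine ⟨_, h4, fun a ha b hb => ?_⟩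
  rw [Metric.mem_ball] at ha hb
  linarith [dist_triangle_right a b (T (L.1 (e j)) x)]

/-- The extension of a non-degenerate bounded representation to the left centralizers. -/
lemma IsBddApproxLeftId.exists_extension [l.NeBot] [CompleteSpace X]
    (he : IsBddApproxLeftId l e) (hT : IsBddRep T) (hn : IsNondegRep T) :
    ∃ Tbar : leftCentralizers 𝕜 B →ₐ[𝕜] (X →L[𝕜] X),
      (∀ b, Tbar (leftMul 𝕜 b) = T b) ∧ ∃ C : ℝ, ∀ L, ‖Tbar L‖ ≤ C * ‖L‖ := by
  choose φ hφ using he.exists_tendsto hT hn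
  obtain ⟨M, hM⟩ := he.bounded
  have hM0 : 0 ≤ M := by
    obtain ⟨i⟩ := l.nonempty_of_neBot
    exact (norm_nonneg _).trans (hM i)
  have hb : ∀ L x, ‖φ L x‖ ≤ (‖hT.toCLM‖ * M * ‖L‖) * ‖x‖ := fun L x => by
    refine le_of_tendsto (hφ L x).norm (Eventually.of_forall fun i => ?_)
    refine (T (L.1 (e i))).le_of_opNorm_le ((hT.toCLM.le_opNorm _).trans ?_) x
    rw [mul_assoc, mul_comm M]
    exact mul_le_mul_of_nonneg_left (L.1.le_of_opNorm_le_of_le le_rfl (hM i)) (norm_nonneg _)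
  let Φ : leftCentralizers 𝕜 B → X →L[𝕜] X := fun L => LinearMap.mkContinuous
    { toFun := φ L
      map_add' := fun x y => tendsto_nhds_unique (hφ L _) (by
        simpa only [map_add] using (hφ L x).add (hφ L y))
      map_smul' := fun c x => tendsto_nhds_unique (hφ L _) (by
        simpa only [map_smul, RingHom.id_apply] using (hφ L x).const_smul c) } _ (hb L)
  -- With `hext`, this formula reduces every algebraic identity for `Φ` to an identity between left
  -- centralizers.
  have hΦ : ∀ L b x, Φ L (T b x) = T (L.1 b) x := fun L b x => by
    refine tendsto_nhds_unique (hφ L _) ?_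
    simp only [← rep_mul_apply, ← leftCentralizers_map_mul]
    exact ((hT.continuous_apply x).tendsto _).comp ((L.1.continuous.tendsto _).comp
      (he.tendsto_mul b))
  have hext : ∀ S S' : X →L[𝕜] X, (∀ b x, S (T b x) = S' (T b x)) → S = S' := fun S S' h =>
    ContinuousLinearMap.ext fun x =>
      he.rep_induction hT hn (isClosed_eq S.continuous S'.continuous) h x
  refine ⟨AlgHom.ofLinearMap
    { toFun := Φ
      map_add' := fun L L' => hext _ _ fun b x => by
        rw [_root_.add_apply, hΦ, hΦ, hΦ, ← _root_.add_apply, ← map_add]; rfl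
      map_smul' := fun c L => hext _ _ fun b x => by
        rw [RingHom.id_apply, _root_.smul_apply, hΦ, hΦ, ← _root_.smul_apply, ← map_smul]; rfl }
    (hext _ _ fun b x => hΦ 1 b x) fun L L' => hext _ _ fun b x => ?_, fun b => ?_,
    ‖hT.toCLM‖ * M, fun L => ?_⟩
  · change Φ (L * L') (T b x) = Φ L (Φ L' (T b x))
    rw [hΦ, hΦ, hΦ]; rfl
  · refine hext _ _ fun c x => ?_
    change Φ (leftMul 𝕜 b) (T c x) = _
    rw [hΦ, ← rep_mul_apply]; rfl
  · exact LinearMap.mkContinuous_norm_le _ (by positivity) (hb L)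

end Net

end Extension

/-! ### Approximate identities of functions on the group -/

section Bump

variable {G : Type*} [Group G] [TopologicalSpace G] [IsTopologicalGroup G] [LocallyCompactSpace G]
  [MeasurableSpace G] [BorelSpace G] (μ : Measure G) [μ.IsHaarMeasure]

/-- A Urysohn function equal to 1 at the identity and vanishing off the interior of a compact
neighbourhood has positive integral and can be normalised. -/
lemma exists_bump [T2Space G] {V : Set G} (hV : V ∈ 𝓝 (1 : G)) :
    ∃ z : C_c(G, ℝ), (∀ s, 0 ≤ z s) ∧ tsupport z ⊆ V ∧ ∫ s, z s ∂μ = 1 := by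
  obtain ⟨K, hK, hKV, hKc⟩ := local_compact_nhds hV
  obtain ⟨f, hf1, hf0, hfc, hf⟩ := exists_continuous_one_zero_of_isCompact
    (isCompact_singleton (x := (1 : G))) (isOpen_interior (s := K)).isClosed_compl
    (Set.disjoint_singleton_left.2 fun h => h (mem_interior_iff_mem_nhds.2 hK))
  have hpos : 0 < ∫ s, f s ∂μ := f.continuous.integral_pos_of_hasCompactSupport_nonneg_nonzero
    hfc (fun s => (hf s).1) (x := 1) (by rw [hf1 rfl]; exact one_ne_zero)
  have hsupp : tsupport f ⊆ K := by
    refine closure_minimal (fun s hs => ?_) hKc.isClosed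
    by_contra h
    exact hs (hf0 fun h' => h (interior_subset h'))
  refine ⟨(∫ s, f s ∂μ)⁻¹ • ⟨f, hfc⟩, fun s => ?_, ?_, ?_⟩
  · exact mul_nonneg (inv_nonneg.2 hpos.le) (hf s).1
  · refine subset_trans (closure_mono (t := Function.support f) fun s hs h0 => hs ?_)
      (hsupp.trans hKV)
    change (∫ s, f s ∂μ)⁻¹ * f s = 0
    rw [h0, mul_zero]
  · change ∫ s, (∫ s, f s ∂μ)⁻¹ * f s ∂μ = 1
    rw [integral_const_mul, inv_mul_cancel₀ hpos.ne']

/-- Averaging a continuous function over a small set changes its value by little. -/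
lemma norm_vint_smul_sub_le {𝕜 E : Type*} [RCLike 𝕜] [NormedAddCommGroup E] [NormedSpace 𝕜 E]
    [CompleteSpace E] {z : C_c(G, ℝ)} (hz0 : ∀ s, 0 ≤ z s) (hz1 : ∫ s, z s ∂μ = 1) {h : G → E} (hh : Continuous h)
    {y : E} {ε : ℝ} (hε : ∀ s ∈ tsupport z, ‖h s - y‖ ≤ ε) :
    ‖vint 𝕜 μ (fun s => (z s : 𝕜) • h s) - y‖ ≤ ε := by
  let : NormedSpace ℝ E := NormedSpace.restrictScalars ℝ 𝕜 E
  have hs : ∀ (c : ℝ) (x : E), (c : 𝕜) • x = c • x := fun c x => rfl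
  have hzi : Integrable z μ := z.continuous.integrable_of_hasCompactSupport z.hasCompactSupport
  have hint : Integrable (fun s => z s • h s) μ :=
    (z.continuous.smul hh).integrable_of_hasCompactSupport z.hasCompactSupport.smul_right
  have hy : ∫ s, z s • y ∂μ = y := by rw [integral_smul_const, hz1, one_smul]
  change ‖∫ s, (z s : 𝕜) • h s ∂μ - y‖ ≤ ε
  simp only [hs]
  -- As `z` has integral 1, the vector `y` is the average of the constant function `y`.
  calc _ = ‖∫ s, z s • (h s - y) ∂μ‖ := by
        simp only [smul_sub]
        rw [integral_sub hint (hzi.smul_const y), hy]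
    _ ≤ ∫ s, z s * ε ∂μ := norm_integral_le_of_norm_le (hzi.mul_const ε)
        (Eventually.of_forall fun s => by
          rw [norm_smul, Real.norm_of_nonneg (hz0 s)]
          by_cases h : s ∈ tsupport z
          · exact mul_le_mul_of_nonneg_left (hε s h) (hz0 s)
          · simp [image_eq_zero_of_notMem_tsupport h])
    _ = ε := by rw [integral_mul_const, hz1, one_mul]

/-- The function `s ↦ z(s) a`. -/
def elemTensor (𝕜 : Type*) {A : Type*} [RCLike 𝕜] [NonUnitalNormedRing A] [NormedSpace 𝕜 A]
    (z : C_c(G, ℝ)) (a : A) : C_c(G, A) where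
  toFun s := (z s : 𝕜) • a
  continuous_toFun := (RCLike.continuous_ofReal.comp z.continuous).smul continuous_const
  hasCompactSupport' := z.hasCompactSupport.mono fun s hs hz => hs (by simp [hz])

lemma elemTensor_apply (𝕜 : Type*) {A : Type*} [RCLike 𝕜] [NonUnitalNormedRing A]
    [NormedSpace 𝕜 A] (z : C_c(G, ℝ)) (a : A) (s : G) :
    elemTensor 𝕜 z a s = (z s : 𝕜) • a := rfl

lemma tsupport_elemTensor_subset (𝕜 : Type*) {A : Type*} [RCLike 𝕜] [NonUnitalNormedRing A]
    [NormedSpace 𝕜 A] (z : C_c(G, ℝ)) (a : A) : tsupport (elemTensor 𝕜 z a) ⊆ tsupport z :=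
  closure_mono fun s hs hz => hs (by simp [elemTensor_apply, hz])

end Bump

/-! ### Compactness and continuity tools, and estimates in the crossed product -/

section System

variable {𝕜 A G : Type*} [RCLike 𝕜] [NonUnitalNormedRing A] [NormedSpace 𝕜 A]
  [Group G] [TopologicalSpace G]

/-- A bounded approximate left identity converges uniformly on compact sets. -/
lemma IsBddApproxLeftId.eventually_norm_sub_le {ι : Type*} {l : Filter ι} {e : ι → A}
    (he : IsBddApproxLeftId l e) {K : Set A} (hK : IsCompact K) {ε : ℝ} (hε : 0 < ε) :
    ∀ᶠ i in l, ∀ a ∈ K, ‖e i * a - a‖ ≤ ε := by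
  obtain ⟨M, hM⟩ := he.bounded
  -- Chosen so that `|M| * δ + δ = ε / 2`: moving from `a` to a point of a finite `δ`-net costs `ε /
  -- 2`, and on the finite net pointwise convergence suffices.
  set δ := ε / (2 * (|M| + 1)) with hδ
  have hδ0 : 0 < δ := by positivity
  obtain ⟨t, -, ht, htK⟩ := hK.finite_cover_balls hδ0
  have h1 : ∀ᶠ i in l, ∀ b ∈ t, ‖e i * b - b‖ < ε / 2 :=
    ht.eventually_all.2 fun b _ => by
      simpa only [dist_eq_norm] using Metric.tendsto_nhds.1 (he.tendsto_mul b) (ε / 2) (by positivity)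
  filter_upwards [h1] with i hi a ha
  obtain ⟨b, hb, hab⟩ := Set.mem_iUnion₂.1 (htK ha)
  rw [Metric.mem_ball, dist_eq_norm] at hab
  have e1 : e i * a - a = (e i * b - b) + (e i * (a - b) - (a - b)) := by rw [mul_sub]; abel
  have e2 : ‖e i * (a - b)‖ ≤ |M| * δ := (norm_mul_le _ _).trans
    (mul_le_mul ((hM i).trans (le_abs_self M)) hab.le (norm_nonneg _) (abs_nonneg _))
  have e3 : |M| * δ + δ = ε / 2 := by rw [hδ]; field_simp
  rw [e1]
  linarith [norm_add_le (e i * b - b) (e i * (a - b) - (a - b)),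
    norm_sub_le (e i * (a - b)) (a - b), hi b hb]

lemma HasBoundedApproxLeftId.exists_isBddApproxLeftId {A : Type uA} [NonUnitalNormedRing A]
    (hA : HasBoundedApproxLeftId A) :
    ∃ (ι : Type uA) (l : Filter ι) (e : ι → A), l.NeBot ∧ IsBddApproxLeftId l e := by
  obtain ⟨ι, _, _, _, e, hM, he⟩ := hA
  exact ⟨ι, atTop, e, inferInstance, hM, he⟩

/-- A locally bounded group representation that is continuous on a set with dense span is strongly
continuous. -/
lemma continuous_of_dense_span {X : Type*} [NormedAddCommGroup X] [NormedSpace 𝕜 X]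
    {V : G → X →L[𝕜] X} (hV : ∀ r, ∃ M : ℝ, ∀ᶠ t in 𝓝 r, ‖V t‖ ≤ M) {s : Set X}
    (hs : Dense (Submodule.span 𝕜 s : Set X)) (h : ∀ x ∈ s, Continuous fun r => V r x) (x : X) :
    Continuous fun r => V r x :=
  continuous_iff_continuousAt.2 fun r =>
    let ⟨_, hM⟩ := hV r
    tendsto_apply_of_dense_span hM hs (fun x hx => (h x hx).tendsto r) x

variable [IsTopologicalGroup G] [LocallyCompactSpace G] [CompleteSpace A] [MeasurableSpace G]
  [BorelSpace G]

/-- As `a` does not depend on `s`, the operator `π(a)` leaves the integral and only an average of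
the orbit of `x` remains. This is how bump functions produce approximate identities. -/
lemma CovRep.integrated_elemTensor {D : DynSys 𝕜 A G} {X : Type*} [NormedAddCommGroup X]
    [NormedSpace 𝕜 X] [CompleteSpace X] (ρ : CovRep D X) (h : ρ.IsContinuous) (μ : Measure G)
    [IsFiniteMeasureOnCompacts μ] (z : C_c(G, ℝ)) (a : A) (x : X) :
    ρ.integrated h μ (elemTensor 𝕜 z a) x = ρ.pi a (vint 𝕜 μ fun s => (z s : 𝕜) • ρ.U s x) := by
  have hint : Integrable (fun s => (z s : 𝕜) • ρ.U s x) μ :=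
    ((RCLike.continuous_ofReal.comp z.continuous).smul (h.2 x)).integrable_of_hasCompactSupport
      (z.hasCompactSupport.mono fun s hs hz => hs (by simp [hz]))
  rw [CovRep.integrated_apply, ← vint_clm 𝕜 μ _ hint]
  simp [elemTensor_apply]

namespace RepClass

variable [IsScalarTower 𝕜 A A] [SMulCommClass 𝕜 A A] {D : DynSys 𝕜 A G} (R : RepClass.{v} D)
  (μ : Measure G) [μ.IsHaarMeasure]

/-! ### Norm estimates in the crossed product -/

/-- The bound `ν` is common to the whole class and bounded on `K`, so one constant serves all
functions supported in `K`. -/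
lemma exists_sigma_le_integral {K : Set G} (hK : IsCompact K) :
    ∃ C : ℝ, 0 ≤ C ∧ ∀ f : C_c(G, A), tsupport f ⊆ K → R.sigma μ f ≤ C * ∫ s, ‖f s‖ ∂μ := by
  obtain ⟨C, ν, hν, h⟩ := R.uniformlyBounded
  obtain ⟨M, hM⟩ := hν K hK
  refine ⟨C * M, by positivity, fun f hf => R.sigma_le μ fun ρ => ?_⟩
  exact ρ.1.2.norm_integrated_le _ μ f C.2 M.2 (h _ ρ.2).1 fun s hs =>
    ((h _ ρ.2).2 s).trans (NNReal.coe_le_coe.2 (hM ⟨s, hf hs, rfl⟩))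

lemma exists_sigma_le_of_norm_le {K : Set G} (hK : IsCompact K) :
    ∃ C : ℝ, 0 ≤ C ∧ ∀ f : C_c(G, A), tsupport f ⊆ K → ∀ ε, (∀ s, ‖f s‖ ≤ ε) →
      R.sigma μ f ≤ C * ε := by
  obtain ⟨C, hC0, hC⟩ := R.exists_sigma_le_integral μ hK
  refine ⟨C * μ.real K, by positivity, fun f hf ε hε => (hC f hf).trans ?_⟩
  rw [mul_assoc]
  refine mul_le_mul_of_nonneg_left ?_ hC0
  rw [← setIntegral_eq_integral_of_forall_compl_eq_zero (s := K) fun s hs => by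
    rw [image_eq_zero_of_notMem_tsupport fun h => hs (hf h), norm_zero]]
  rw [mul_comm]
  exact (le_abs_self _).trans (norm_setIntegral_le_of_norm_le_const (f := fun s => ‖f s‖)
    hK.measure_lt_top fun s _ => by rw [norm_norm]; exact hε s)

/-- An explicit constant is needed to make the bounds for `i_A` linear in `‖a‖` and those for `i_G`
locally uniform. -/
lemma norm_lift_le {S : C_c(G, A) →ₗ[𝕜] C_c(G, A)} {C : ℝ} (hC0 : 0 ≤ C)
    (hC : ∀ f, R.sigma μ (S f) ≤ C * R.sigma μ f) : ‖R.lift μ S ⟨C, hC⟩‖ ≤ C := by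
  refine ContinuousLinearMap.opNorm_le_bound _ hC0 fun c => ?_
  refine R.CP_induction μ (P := fun c => ‖R.lift μ S ⟨C, hC⟩ c‖ ≤ C * ‖c‖)
    (isClosed_le (by fun_prop) (by fun_prop)) (fun f => ?_) c
  rw [lift_q, norm_q, norm_q]
  exact hC f

lemma exists_norm_iA_le : ∃ C : ℝ, 0 ≤ C ∧ ∀ a, ‖R.iA μ a‖ ≤ C * ‖a‖ := by
  obtain ⟨C, ν, -, h⟩ := R.uniformlyBounded
  refine ⟨C, C.2, fun a => R.norm_lift_le μ (mul_nonneg C.2 (norm_nonneg a))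
    fun f => R.sigma_le μ fun ρ => ?_⟩
  rw [normAt, CovRep.integrated_iAfun]
  exact (norm_mul_le _ _).trans (mul_le_mul ((h _ ρ.2).1 a) (R.normAt_le_sigma μ f ρ)
    (norm_nonneg _) (mul_nonneg C.2 (norm_nonneg a)))

lemma exists_norm_iG_le (r : G) : ∃ M : ℝ, ∀ᶠ t in 𝓝 r, ‖R.iG μ t‖ ≤ M := by
  obtain ⟨C, ν, hν, h⟩ := R.uniformlyBounded
  obtain ⟨K, hK, hKr⟩ := exists_compact_mem_nhds r
  obtain ⟨M, hM⟩ := hν K hK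
  refine ⟨M, ?_⟩
  filter_upwards [hKr] with t ht
  refine (R.norm_lift_le μ (ν t).2 fun f => R.sigma_le μ fun ρ => ?_).trans
    (NNReal.coe_le_coe.2 (hM ⟨t, ht, rfl⟩))
  rw [normAt, CovRep.integrated_iGfun]
  exact (norm_mul_le _ _).trans (mul_le_mul ((h _ ρ.2).2 t) (R.normAt_le_sigma μ f ρ)
    (norm_nonneg _) (ν t).2)

lemma dense_span_range_q : Dense (Submodule.span 𝕜 (Set.range (R.q μ)) : Set (R.CP μ)) :=
  (R.denseRange_q μ).mono Submodule.subset_span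

/-! ### Strong continuity of the action of the group on the crossed product -/

/-- For `t` in a compact neighbourhood of `r`, all translates of `f` live on one compact set, where
`σ` is dominated by the `L¹`-norm. The `L¹`-distance to the translate by `r` is continuous in `t`
and vanishes at `t = r`. -/
lemma continuous_q_iGfun [T2Space G] (f : C_c(G, A)) :
    Continuous fun r => R.q μ (iGfun D r f) := by
  rw [continuous_iff_continuousAt]
  intro r
  obtain ⟨N, hN, hNr⟩ := exists_compact_mem_nhds r
  have hrN : r ∈ N := mem_of_mem_nhds hNr
  set K : Set G := (fun p : G × G => p.1 * p.2) '' (N ×ˢ tsupport f) with hKdef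
  have hK : IsCompact K := (hN.prod f.hasCompactSupport).image continuous_mul
  have hzero : ∀ t ∈ N, ∀ s, s ∉ K → iGfun D t f s = 0 := fun t ht s hs => by
    rw [iGfun_apply, image_eq_zero_of_notMem_tsupport fun h => hs ⟨(t, t⁻¹ * s), ⟨ht, h⟩, by simp⟩,
      map_zero]
  obtain ⟨C, hC0, hC⟩ := R.exists_sigma_le_integral μ hK
  have hbd : ∀ t ∈ N, ‖R.q μ (iGfun D t f) - R.q μ (iGfun D r f)‖
      ≤ C * ∫ s, ‖iGfun D t f s - iGfun D r f s‖ ∂μ := fun t ht => by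
    rw [← map_sub, norm_q]
    refine hC _ (closure_minimal (fun s hs => ?_) hK.isClosed)
    by_contra h
    refine hs ?_
    change iGfun D t f s - iGfun D r f s = 0
    rw [hzero t ht s h, hzero r hrN s h, sub_zero]
  have hcont : ContinuousOn (fun t => C * ∫ s, ‖iGfun D t f s - iGfun D r f s‖ ∂μ) N := by
    refine continuousOn_const.mul (continuousOn_integral_of_compact_support hK ?_ ?_)
    · have h1 : Continuous fun p : G × G => D.act p.1 (f (p.1⁻¹ * p.2)) :=
        D.continuous_uncurry.comp (f := fun p : G × G => (p.1, f (p.1⁻¹ * p.2))) (by fun_prop)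
      exact (h1.sub ((iGfun D r f).continuous.comp continuous_snd)).norm.continuousOn
    · intro t s ht hs
      rw [hzero t ht s hs, hzero r hrN s hs, sub_zero, norm_zero]
  have h0 := (hcont.continuousAt hNr).tendsto
  simp only [sub_self, norm_zero, integral_zero, mul_zero] at h0
  rw [ContinuousAt, tendsto_iff_norm_sub_tendsto_zero]
  refine squeeze_zero' (Eventually.of_forall fun _ => norm_nonneg _) ?_ h0
  filter_upwards [hNr] with t ht using hbd t ht

lemma continuous_iG_apply [T2Space G] (c : R.CP μ) : Continuous fun r => (R.iG μ r).1 c := by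
  refine continuous_of_dense_span (𝕜 := 𝕜) (V := fun r => (R.iG μ r).1) (R.exists_norm_iG_le μ)
    (R.dense_span_range_q μ) ?_ c
  rintro _ ⟨f, rfl⟩
  simp only [iG_q]
  exact R.continuous_q_iGfun μ f

/-! ### The crossed product as a covariant representation -/

/-- The covariant representation `(i_A, i_G)` on the crossed product. -/
def leftRegular : CovRep D (R.CP μ) := R.ofCentralizers μ (leftCentralizers 𝕜 (R.CP μ)).val

lemma leftRegular_pi (a : A) : (R.leftRegular μ).pi a = (R.iA μ a).1 := rfl

lemma leftRegular_U (r : G) : (R.leftRegular μ).U r = (R.iG μ r).1 := rfl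

lemma leftRegular_isContinuous [T2Space G] : (R.leftRegular μ).IsContinuous :=
  ⟨(R.exists_norm_iA_le μ).imp fun _ h => h.2, R.continuous_iG_apply μ⟩

lemma isRContinuous_of_mem (ρ : R.carrier) : R.IsRContinuous μ ρ.1.2 :=
  ⟨R.isContinuous _ ρ.2, 1, fun f => by
    rw [one_mul]; exact R.normAt_le_sigma μ f ρ⟩

lemma isBddRep_integratedRep {X : Type*} [NormedAddCommGroup X] [NormedSpace 𝕜 X]
    [CompleteSpace X] (ρ : CovRep D X) (h : R.IsRContinuous μ ρ) :
    IsBddRep (R.integratedRep μ ρ h) :=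
  ⟨_, (R.extCP μ (ρ.integrated h.1 μ) h.2).le_opNorm⟩

lemma continuous_integratedRep {X : Type*} [NormedAddCommGroup X] [NormedSpace 𝕜 X]
    [CompleteSpace X] (ρ : CovRep D X) (h : R.IsRContinuous μ ρ) :
    Continuous (R.integratedRep μ ρ h) :=
  (R.extCP μ (ρ.integrated h.1 μ) h.2).continuous

/-- The integrated forms of the elements of the class separate the points of the crossed
product. -/
lemma CP_eq_of_integratedRep_eq {a b : R.CP μ}
    (h : ∀ ρ : R.carrier, R.integratedRep μ ρ.1.2 (R.isRContinuous_of_mem μ ρ) a =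
      R.integratedRep μ ρ.1.2 (R.isRContinuous_of_mem μ ρ) b) : a = b := by
  have h1 : ∀ (ρ : R.carrier) (c : R.CP μ),
      ‖R.integratedRep μ ρ.1.2 (R.isRContinuous_of_mem μ ρ) c‖ ≤ ‖c‖ := fun ρ c => by
    refine R.CP_induction μ (isClosed_le (R.continuous_integratedRep μ _ _).norm continuous_norm)
      (fun f => ?_) c
    rw [integratedRep_q, norm_q]
    exact R.normAt_le_sigma μ f ρ
  rw [← sub_eq_zero, ← norm_le_zero_iff]
  refine le_of_forall_pos_le_add fun ε hε => ?_
  obtain ⟨f, hf⟩ := (R.denseRange_q μ).exists_dist_lt (a - b) (half_pos hε)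
  rw [dist_eq_norm] at hf
  -- Each integrated form takes equal values at `a` and `b`, so its norm at `q f` is its norm at `a
  -- - b - q f`. The supremum over the class of the former is `‖q f‖`.
  have h2 : ‖R.q μ f‖ ≤ ‖a - b - R.q μ f‖ := by
    rw [norm_q]
    refine R.sigma_le μ fun ρ => (le_of_eq ?_).trans (h1 ρ (a - b - R.q μ f))
    rw [map_sub, map_sub, h ρ, sub_self, zero_sub, norm_neg, integratedRep_q]
    rfl
  have h3 := norm_add_le (a - b - R.q μ f) (R.q μ f)
  rw [sub_add_cancel] at h3
  linarith

/-- The integrated form of `(i_A, i_G)` is left multiplication. -/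
lemma leftRegular_integrated_apply [T2Space G] (f : C_c(G, A)) (c : R.CP μ) :
    (R.leftRegular μ).integrated (R.leftRegular_isContinuous μ) μ f c = R.q μ f * c := by
  refine R.CP_induction μ (isClosed_eq (ContinuousLinearMap.continuous _) (by fun_prop))
    (fun g => R.CP_eq_of_integratedRep_eq μ fun ρ => ContinuousLinearMap.ext fun x => ?_) c
  set hρ := R.isRContinuous_of_mem μ ρ
  -- A Bochner integral in the completion cannot be evaluated as a function on `G`. It is tested
  -- instead by `T` and `x`, where `T` is the integrated form of a member `(π, U)` of the class;
  -- under `T`, `i_A` and `i_G` become left multiplication by `π` and `U`, and the integral becomes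
  -- `π ⋊ U (f)` applied to `π ⋊ U (g) x`.
  have key := vint_clm 𝕜 μ ((ContinuousLinearMap.apply 𝕜 ρ.1.1 x).comp
    (R.isBddRep_integratedRep μ ρ.1.2 hρ).toCLM)
    ((R.leftRegular μ).integrable_integrand (R.leftRegular_isContinuous μ) μ f (R.q μ g))
  simp only [ContinuousLinearMap.comp_apply, IsBddRep.toCLM_apply,
    ContinuousLinearMap.apply_apply, leftRegular_pi, leftRegular_U, iG_q, iA_q, integratedRep_q,
    CovRep.integrated_iAfun, CovRep.integrated_iGfun, mul_apply_eq_comp] at key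
  rw [CovRep.integrated_apply, q_mul_q, integratedRep_q, CovRep.integrated_conv,
    mul_apply_eq_comp, CovRep.integrated_apply]
  simp only [leftRegular_pi, leftRegular_U, iG_q, iA_q]
  exact key.symm

/-! ### Approximate identities of the crossed product -/

/-- A function `f` in `C_c(G, A)` has compact range, so `e i * f s → f s` uniformly in `s`. Since
the supports stay inside that of `f`, this gives convergence in `σ`; uniform boundedness extends it
to the completion. -/
lemma tendsto_iA_apply {ι : Type*} {l : Filter ι} {e : ι → A} (he : IsBddApproxLeftId l e)
    (c : R.CP μ) : Tendsto (fun i => (R.iA μ (e i)).1 c) l (𝓝 c) := by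
  obtain ⟨M, hM⟩ := he.bounded
  obtain ⟨C, hC0, hC⟩ := R.exists_norm_iA_le μ
  refine tendsto_apply_of_dense_span (S := fun i => (R.iA μ (e i)).1)
    (S₀ := ContinuousLinearMap.id 𝕜 (R.CP μ)) (M := C * M)
    (Eventually.of_forall fun i => (hC (e i)).trans (mul_le_mul_of_nonneg_left (hM i) hC0))
    (R.dense_span_range_q μ) ?_ c
  rintro _ ⟨f, rfl⟩
  obtain ⟨C', hC'0, hC'⟩ := R.exists_sigma_le_of_norm_le μ f.hasCompactSupport.isCompact
  rw [Metric.tendsto_nhds]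
  intro ε hε
  filter_upwards [he.eventually_norm_sub_le (f.hasCompactSupport.isCompact_range f.continuous)
    (show 0 < ε / (C' + 1) by positivity)] with i hi
  rw [iA_q, ContinuousLinearMap.id_apply, dist_eq_norm, ← map_sub, norm_q]
  refine (hC' _ (closure_mono fun s hs h0 => hs ?_) _ fun s => hi (f s) ⟨s, rfl⟩).trans_lt ?_
  · change e i * f s - f s = 0
    rw [h0, mul_zero, sub_zero]
  · rw [mul_div_assoc', div_lt_iff₀ (by positivity)]
    nlinarith

/-- The element `b` is `q (z ⊗ e i)`: its product with `c` is `i_A(e i)` applied to the `z`-average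
of `i_G(s) c`, and both operations move `c` only slightly. -/
lemma exists_norm_mul_sub_le [T2Space G] {ι : Type*} {l : Filter ι} [l.NeBot] {e : ι → A}
    (he : IsBddApproxLeftId l e) :
    ∃ M : ℝ, ∀ (F : Finset (R.CP μ)) (ε : ℝ), 0 < ε →
      ∃ b : R.CP μ, ‖b‖ ≤ M ∧ ∀ c ∈ F, ‖b * c - c‖ ≤ ε := by
  obtain ⟨M, hM⟩ := he.bounded
  obtain ⟨K, hK, hK1⟩ := exists_compact_mem_nhds (1 : G)
  obtain ⟨C, hC0, hC⟩ := R.exists_norm_iA_le μ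
  obtain ⟨C', hC'0, hC'⟩ := R.exists_sigma_le_integral μ hK
  refine ⟨C' * M, fun F ε hε => ?_⟩
  -- The error `δ` of averaging is multiplied by the norm of `i_A(e i)`, which is at most `C * |M|`.
  set δ := ε / (2 * (C * |M| + 1)) with hδ
  have hδ0 : 0 < δ := by positivity
  have hV : ∀ᶠ r in 𝓝 (1 : G), ∀ c ∈ F, ‖(R.iG μ r).1 c - c‖ ≤ δ := by
    refine (Finset.eventually_all F).2 fun c _ => ?_
    have h1 := (R.continuous_iG_apply μ c).tendsto 1
    rw [map_one] at h1
    filter_upwards [Metric.tendsto_nhds.1 h1 δ hδ0] with r hr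
    rw [dist_eq_norm] at hr
    exact hr.le
  have hF : ∀ᶠ i in l, ∀ c ∈ F, ‖(R.iA μ (e i)).1 c - c‖ ≤ ε / 2 := by
    refine (Finset.eventually_all F).2 fun c _ => ?_
    filter_upwards [Metric.tendsto_nhds.1 (R.tendsto_iA_apply μ he c) (ε / 2) (by positivity)]
      with i hi
    rw [dist_eq_norm] at hi
    exact hi.le
  -- Intersecting with the fixed compact `K` keeps the norm of `q (z ⊗ e i)` bounded independently
  -- of `F` and `ε`.
  obtain ⟨z, hz0, hzV, hz1⟩ := exists_bump μ (inter_mem hV hK1)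
  obtain ⟨i, hi⟩ := hF.exists
  refine ⟨R.q μ (elemTensor 𝕜 z (e i)), ?_, fun c hc => ?_⟩
  · rw [norm_q]
    refine (hC' _ ((tsupport_elemTensor_subset 𝕜 z (e i)).trans
      (hzV.trans Set.inter_subset_right))).trans (mul_le_mul_of_nonneg_left ?_ hC'0)
    have : ∀ s, ‖elemTensor 𝕜 z (e i) s‖ = z s * ‖e i‖ := fun s => by
      rw [elemTensor_apply, norm_smul, RCLike.norm_ofReal, abs_of_nonneg (hz0 s)]
    simp only [this]
    rw [integral_mul_const, hz1, one_mul]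
    exact hM i
  · rw [← leftRegular_integrated_apply, CovRep.integrated_elemTensor, leftRegular_pi]
    simp only [leftRegular_U]
    set y := vint 𝕜 μ fun s => (z s : 𝕜) • (R.iG μ s).1 c
    have h1 : ‖y - c‖ ≤ δ := norm_vint_smul_sub_le μ hz0 hz1 (R.continuous_iG_apply μ c)
      fun s hs => (hzV hs).1 c hc
    have h2 : ‖(R.iA μ (e i)).1 (y - c)‖ ≤ C * |M| * δ :=
      (R.iA μ (e i)).1.le_of_opNorm_le_of_le ((hC (e i)).trans
        (mul_le_mul_of_nonneg_left ((hM i).trans (le_abs_self M)) hC0)) h1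
    have h3 : C * |M| * δ ≤ ε / 2 := by
      have : (C * |M| + 1) * δ = ε / 2 := by rw [hδ]; field_simp
      linarith
    have h4 := norm_add_le ((R.iA μ (e i)).1 (y - c)) ((R.iA μ (e i)).1 c - c)
    rw [map_sub, sub_add_sub_cancel] at h4
    rw [map_sub] at h2
    linarith [hi c hc]

/-- If `A` has a bounded approximate left identity, then so has the crossed product. -/
lemma exists_isBddApproxLeftId [T2Space G] {ι : Type*} {l : Filter ι} [l.NeBot] {e : ι → A}
    (he : IsBddApproxLeftId l e) :
    ∃ (l : Filter (Finset (R.CP μ) × ℕ)) (b : Finset (R.CP μ) × ℕ → R.CP μ),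
      l.NeBot ∧ IsBddApproxLeftId l b := by
  classical
  obtain ⟨M, hM⟩ := R.exists_norm_mul_sub_le μ he
  -- The directed set consists of pairs (finite set to be approximated, precision).
  choose b hb1 hb2 using fun p : Finset (R.CP μ) × ℕ => hM p.1 (1 / ((p.2 : ℝ) + 1)) (by positivity)
  refine ⟨atTop, b, inferInstance, ⟨M, hb1⟩, fun c => ?_⟩
  rw [Metric.tendsto_nhds]
  intro ε hε
  obtain ⟨n, hn⟩ := exists_nat_one_div_lt hε
  filter_upwards [eventually_ge_atTop ({c}, n)] with p hp
  rw [dist_eq_norm]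
  refine (hb2 p c (hp.1 (Finset.mem_singleton_self c))).trans_lt (lt_of_le_of_lt ?_ hn)
  have : (n : ℝ) ≤ p.2 := by exact_mod_cast hp.2
  gcongr

end RepClass

end System

/-! ### Integration and separation, and what they preserve -/

section System

/-- A closed subspace is complete, so the integral can be formed inside `Z` and then included. -/
lemma vint_mem {𝕜 G E : Type*} [RCLike 𝕜] [NormedAddCommGroup E] [NormedSpace 𝕜 E]
    [CompleteSpace E] [TopologicalSpace G] [MeasurableSpace G] [OpensMeasurableSpace G]
    (μ : Measure G) [IsFiniteMeasureOnCompacts μ] {Z : Submodule 𝕜 E} (hZ : IsClosed (Z : Set E))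
    {f : G → E} (hf : Continuous f) (hfc : HasCompactSupport f) (h : ∀ s, f s ∈ Z) :
    vint 𝕜 μ f ∈ Z := by
  have := hZ.completeSpace_coe
  have hg : Continuous fun s => (⟨f s, h s⟩ : Z) := hf.subtype_mk h
  have hgc : HasCompactSupport fun s => (⟨f s, h s⟩ : Z) :=
    hfc.mono fun s hs h0 => hs (Subtype.ext h0)
  have := vint_clm 𝕜 μ Z.subtypeL (hg.integrable_of_hasCompactSupport hgc)
  simp only [Submodule.subtypeL_apply] at this
  rw [this]
  exact Subtype.property _

variable {𝕜 A G : Type*} [RCLike 𝕜] [NonUnitalNormedRing A] [NormedSpace 𝕜 A]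
  [Group G] [TopologicalSpace G] [IsTopologicalGroup G] [LocallyCompactSpace G] [CompleteSpace A]
  [MeasurableSpace G] [BorelSpace G] [IsScalarTower 𝕜 A A] [SMulCommClass 𝕜 A A]
  {D : DynSys 𝕜 A G}

lemma CovRep.ext_apply {X : Type*} [NormedAddCommGroup X] [NormedSpace 𝕜 X] {ρ τ : CovRep D X}
    (hpi : ∀ a x, ρ.pi a x = τ.pi a x) (hU : ∀ s x, ρ.U s x = τ.U s x) : ρ = τ := by
  obtain ⟨π, U, _⟩ := ρ
  obtain ⟨π', U', _⟩ := τ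
  obtain rfl : π = π' := NonUnitalAlgHom.ext fun a => ContinuousLinearMap.ext (hpi a)
  obtain rfl : U = U' := MonoidHom.ext fun s => ContinuousLinearMap.ext (hU s)
  rfl

namespace RepClass

variable (R : RepClass.{v} D) (μ : Measure G) [μ.IsHaarMeasure]

variable {X Y : Type*} [NormedAddCommGroup X] [NormedSpace 𝕜 X] [CompleteSpace X]
  [NormedAddCommGroup Y] [NormedSpace 𝕜 Y] [CompleteSpace Y]

/-! ### Integration -/

/-- Together with its analogue for `i_G`, this shows how `(π, U)` can be read off from its
integrated form. -/
lemma integratedRep_iA_apply (ρ : CovRep D X) (h : R.IsRContinuous μ ρ) (a : A) (c : R.CP μ)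
    (x : X) : R.integratedRep μ ρ h ((R.iA μ a).1 c) x = ρ.pi a (R.integratedRep μ ρ h c x) := by
  have hT := R.isBddRep_integratedRep μ ρ h
  refine R.CP_induction μ (isClosed_eq
    ((hT.continuous_apply x).comp (R.iA μ a).1.continuous)
    ((ρ.pi a).continuous.comp (hT.continuous_apply x))) (fun f => ?_) c
  simp only [Function.comp_apply]
  rw [iA_q, integratedRep_q, integratedRep_q, CovRep.integrated_iAfun]; rfl

lemma integratedRep_iG_apply (ρ : CovRep D X) (h : R.IsRContinuous μ ρ) (r : G) (c : R.CP μ)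
    (x : X) : R.integratedRep μ ρ h ((R.iG μ r).1 c) x = ρ.U r (R.integratedRep μ ρ h c x) := by
  have hT := R.isBddRep_integratedRep μ ρ h
  refine R.CP_induction μ (isClosed_eq
    ((hT.continuous_apply x).comp (R.iG μ r).1.continuous)
    ((ρ.U r).continuous.comp (hT.continuous_apply x))) (fun f => ?_) c
  simp only [Function.comp_apply]
  rw [iG_q, integratedRep_q, integratedRep_q, CovRep.integrated_iGfun]; rfl

/-- The integrated form of a non-degenerate covariant representation is non-degenerate. -/
lemma isNondegRep_integratedRep [T2Space G] (ρ : CovRep D X) (h : R.IsRContinuous μ ρ)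
    (hn : ρ.IsNondeg) : IsNondegRep (R.integratedRep μ ρ h) := by
  set S := Submodule.span 𝕜 {y : X | ∃ b x, y = R.integratedRep μ ρ h b x}
  have hsub : Submodule.span 𝕜 {y : X | ∃ a x, y = ρ.pi a x} ≤ S.topologicalClosure := by
    refine Submodule.span_le.2 ?_
    rintro _ ⟨a, x, rfl⟩
    refine Metric.mem_closure_iff.2 fun ε hε => ?_
    set δ := ε / (‖ρ.pi a‖ + 1) with hδ
    have hδ0 : 0 < δ := by positivity
    have hV : ∀ᶠ r in 𝓝 (1 : G), ‖ρ.U r x - x‖ ≤ δ := by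
      have h1 := (h.1.2 x).tendsto 1
      rw [map_one] at h1
      filter_upwards [Metric.tendsto_nhds.1 h1 δ hδ0] with r hr
      rw [dist_eq_norm] at hr
      exact hr.le
    obtain ⟨z, hz0, hzV, hz1⟩ := exists_bump μ hV
    -- This vector is `π(a)` applied to an average of `U_s x` near the identity, hence within `ε` of
    -- `π(a) x`.
    refine ⟨_, Submodule.subset_span ⟨R.q μ (elemTensor 𝕜 z a), x, rfl⟩, ?_⟩
    rw [integratedRep_q, CovRep.integrated_elemTensor, dist_comm, dist_eq_norm, ← map_sub]
    refine ((ρ.pi a).le_of_opNorm_le_of_le le_rfl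
      (norm_vint_smul_sub_le μ hz0 hz1 (h.1.2 x) fun s hs => hzV hs)).trans_lt ?_
    rw [hδ, mul_div_assoc', div_lt_iff₀ (by positivity)]
    nlinarith [norm_nonneg (ρ.pi a)]
  have h2 : Dense (S.topologicalClosure : Set X) := hn.mono hsub
  rw [Submodule.topologicalClosure_coe] at h2
  exact dense_closure.1 h2

/-! ### Separation -/

section Separation

variable {ι : Type*} {l : Filter ι} [l.NeBot] {b : ι → R.CP μ}
  {T : R.CP μ →ₙₐ[𝕜] (X →L[𝕜] X)}

/-- Both homomorphisms send `T c y` to `T (L c) y`, and such vectors are dense enough. No continuity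
in `L` is assumed. -/
lemma extends_unique (hb : IsBddApproxLeftId l b) (hT : IsBddRep T)
    (hn : IsNondegRep T) {T₁ T₂ : leftCentralizers 𝕜 (R.CP μ) →ₙₐ[𝕜] (X →L[𝕜] X)}
    (h₁ : R.Extends μ T₁ T) (h₂ : R.Extends μ T₂ T) (L : leftCentralizers 𝕜 (R.CP μ)) :
    T₁ L = T₂ L :=
  ContinuousLinearMap.ext fun x => hb.rep_induction hT hn
    (isClosed_eq (T₁ L).continuous (T₂ L).continuous)
    (fun c y => by rw [extension_apply h₁, extension_apply h₂]) x

/-- Uniqueness makes the choice in `separatedRep` irrelevant. -/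
lemma separatedRep_eq (hb : IsBddApproxLeftId l b) (hT : IsBddRep T)
    (hn : IsNondegRep T) {Tbar : leftCentralizers 𝕜 (R.CP μ) →ₐ[𝕜] (X →L[𝕜] X)}
    (h : R.Extends μ (Tbar : leftCentralizers 𝕜 (R.CP μ) →ₙₐ[𝕜] (X →L[𝕜] X)) T) :
    R.separatedRep μ T = R.ofCentralizers μ Tbar := by
  have hex : ∃ Tbar : leftCentralizers 𝕜 (R.CP μ) →ₐ[𝕜] (X →L[𝕜] X),
    R.Extends μ (Tbar : leftCentralizers 𝕜 (R.CP μ) →ₙₐ[𝕜] (X →L[𝕜] X)) T := ⟨Tbar, h⟩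
  rw [separatedRep, dif_pos hex]
  congr 1
  exact AlgHom.ext fun L => R.extends_unique μ hb hT hn hex.choose_spec h L

lemma exists_separatedRep_eq (hb : IsBddApproxLeftId l b) (hT : IsBddRep T)
    (hn : IsNondegRep T) :
    ∃ Tbar : leftCentralizers 𝕜 (R.CP μ) →ₐ[𝕜] (X →L[𝕜] X),
      R.Extends μ (Tbar : leftCentralizers 𝕜 (R.CP μ) →ₙₐ[𝕜] (X →L[𝕜] X)) T ∧
      (∀ T' : leftCentralizers 𝕜 (R.CP μ) →ₙₐ[𝕜] (X →L[𝕜] X),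
        R.Extends μ T' T → ∀ L, T' L = Tbar L) ∧
      (∃ C : ℝ, ∀ L, ‖Tbar L‖ ≤ C * ‖L‖) ∧ R.separatedRep μ T = R.ofCentralizers μ Tbar := by
  obtain ⟨Tbar, h1, h2⟩ := hb.exists_extension hT hn
  have h3 : R.Extends μ (Tbar : leftCentralizers 𝕜 (R.CP μ) →ₙₐ[𝕜] (X →L[𝕜] X)) T := h1
  exact ⟨Tbar, h3, fun T' hT' L => R.extends_unique μ hb hT hn hT' h3 L, h2,
    R.separatedRep_eq μ hb hT hn h3⟩

lemma separatedRep_pi_apply (hb : IsBddApproxLeftId l b) (hT : IsBddRep T)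
    (hn : IsNondegRep T) (a : A) (c : R.CP μ) (x : X) :
    (R.separatedRep μ T).pi a (T c x) = T ((R.iA μ a).1 c) x := by
  obtain ⟨Tbar, h1, -, -, h3⟩ := R.exists_separatedRep_eq μ hb hT hn
  rw [h3]
  exact extension_apply h1 (R.iA μ a) c x

lemma separatedRep_U_apply (hb : IsBddApproxLeftId l b) (hT : IsBddRep T)
    (hn : IsNondegRep T) (r : G) (c : R.CP μ) (x : X) :
    (R.separatedRep μ T).U r (T c x) = T ((R.iG μ r).1 c) x := by
  obtain ⟨Tbar, h1, -, -, h3⟩ := R.exists_separatedRep_eq μ hb hT hn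
  rw [h3]
  exact extension_apply h1 (R.iG μ r) c x

/-- Boundedness of `T̄` transports the bounds of `i_A` and `i_G`. Strong continuity is then checked
on vectors `T c x`, where `U_r T(c) x = T(i_G(r) c) x`. -/
lemma isContinuous_separatedRep (hb : IsBddApproxLeftId l b) (hT : IsBddRep T)
    (hn : IsNondegRep T) [T2Space G] : (R.separatedRep μ T).IsContinuous := by
  have hU := R.separatedRep_U_apply μ hb hT hn
  obtain ⟨Tbar, -, -, ⟨C, hC⟩, h3⟩ := R.exists_separatedRep_eq μ hb hT hn
  obtain ⟨C', -, hC'⟩ := R.exists_norm_iA_le μ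
  have hC1 : ∀ L, ‖Tbar L‖ ≤ |C| * ‖L‖ := fun L =>
    (hC L).trans (mul_le_mul_of_nonneg_right (le_abs_self C) (norm_nonneg _))
  refine ⟨⟨|C| * C', fun a => ?_⟩, continuous_of_dense_span (fun r => ?_) hn ?_⟩
  · rw [h3, mul_assoc]
    exact (hC1 _).trans (mul_le_mul_of_nonneg_left (hC' a) (abs_nonneg C))
  · obtain ⟨M, hM⟩ := R.exists_norm_iG_le μ r
    refine ⟨|C| * M, hM.mono fun t ht => ?_⟩
    rw [h3]
    exact (hC1 _).trans (mul_le_mul_of_nonneg_left ht (abs_nonneg C))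
  · rintro _ ⟨c, x, rfl⟩
    simp only [hU]
    exact (hT.continuous_apply x).comp (R.continuous_iG_apply μ c)

/-- The approximate identity of `A` gives `π(e_i) T(c) y = T(i_A(e_i) c) y → T(c) y`; that of `B`
makes the vectors `T(c) y` dense. -/
lemma isNondeg_separatedRep (hb : IsBddApproxLeftId l b) (hT : IsBddRep T)
    (hn : IsNondegRep T) {κ : Type*} {m : Filter κ} [m.NeBot] {e : κ → A}
    (he : IsBddApproxLeftId m e) : (R.separatedRep μ T).IsNondeg := by
  refine fun x => hb.rep_induction hT hn isClosed_closure (fun c y => ?_) x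
  have h1 := ((hT.continuous_apply y).tendsto c).comp (R.tendsto_iA_apply μ he c)
  refine mem_closure_of_tendsto h1 (Eventually.of_forall fun i => Submodule.subset_span ?_)
  exact ⟨e i, T c y, (R.separatedRep_pi_apply μ hb hT hn (e i) c y).symm⟩

/-- The integrated form of the covariant representation obtained from `T` is `T`. -/
lemma integrated_separatedRep (hb : IsBddApproxLeftId l b) (hT : IsBddRep T)
    (hn : IsNondegRep T) [T2Space G] (h : (R.separatedRep μ T).IsContinuous)
    (f : C_c(G, A)) : (R.separatedRep μ T).integrated h μ f = T (R.q μ f) := by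
  refine ContinuousLinearMap.ext fun x => hb.rep_induction hT hn
    (isClosed_eq (ContinuousLinearMap.continuous _) (ContinuousLinearMap.continuous _))
    (fun c y => ?_) x
  -- Applying `T` to `q(f) c = ∫ i_A(f(s)) i_G(s) c ds` gives `T(q f) T(c) y` on one side and the
  -- integrated form at `T(c) y` on the other.
  have key := vint_clm 𝕜 μ ((ContinuousLinearMap.apply 𝕜 X y).comp hT.toCLM)
    ((R.leftRegular μ).integrable_integrand (R.leftRegular_isContinuous μ) μ f c)
  simp only [ContinuousLinearMap.comp_apply, IsBddRep.toCLM_apply,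
    ContinuousLinearMap.apply_apply] at key
  rw [← CovRep.integrated_apply _ (R.leftRegular_isContinuous μ),
    leftRegular_integrated_apply, rep_mul_apply] at key
  rw [CovRep.integrated_apply]
  simp only [R.separatedRep_pi_apply μ hb hT hn, R.separatedRep_U_apply μ hb hT hn]
  exact key

lemma isRContinuous_separatedRep (hb : IsBddApproxLeftId l b) (hT : IsBddRep T)
    (hn : IsNondegRep T) [T2Space G] : R.IsRContinuous μ (R.separatedRep μ T) := by
  have h := R.isContinuous_separatedRep μ hb hT hn
  refine ⟨h, hT.imp fun C hC f => ?_⟩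
  rw [R.integrated_separatedRep μ hb hT hn, ← norm_q]
  exact hC _

lemma integratedRep_separatedRep (hb : IsBddApproxLeftId l b) (hT : IsBddRep T)
    (hn : IsNondegRep T) [T2Space G] (h : R.IsRContinuous μ (R.separatedRep μ T)) :
    R.integratedRep μ (R.separatedRep μ T) h = T := by
  refine NonUnitalAlgHom.ext fun c => ?_
  refine R.CP_induction μ (isClosed_eq (R.continuous_integratedRep μ _ _) hT.toCLM.continuous)
    (fun f => ?_) c
  rw [integratedRep_q, R.integrated_separatedRep μ hb hT hn]; rfl

end Separation

section Net

variable {ι : Type*} {l : Filter ι} [l.NeBot] {b : ι → R.CP μ}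
  {ρ : CovRep D X} {τ : CovRep D Y}

lemma separatedRep_integratedRep (hb : IsBddApproxLeftId l b)
    (h : R.IsRContinuous μ ρ)
    (hn : IsNondegRep (R.integratedRep μ ρ h)) :
    R.separatedRep μ (R.integratedRep μ ρ h) = ρ := by
  have hT := R.isBddRep_integratedRep μ ρ h
  refine CovRep.ext_apply (fun a => ?_) (fun r => ?_)
  · refine hb.rep_induction hT hn (isClosed_eq (ContinuousLinearMap.continuous _)
      (ContinuousLinearMap.continuous _)) fun c y => ?_
    rw [R.separatedRep_pi_apply μ hb hT hn, integratedRep_iA_apply]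
  · refine hb.rep_induction hT hn (isClosed_eq (ContinuousLinearMap.continuous _)
      (ContinuousLinearMap.continuous _)) fun c y => ?_
    rw [R.separatedRep_U_apply μ hb hT hn, integratedRep_iG_apply]

/-! ### Invariant subspaces and intertwining operators -/

/-- Closedness serves both directions: `π(a) x` and `U_r x` are limits of `T(i_A(a) b_i) x` and
`T(i_G(r) b_i) x`, while `T(q f) x` is an integral of vectors in `Z`. -/
lemma isInvariantRep_integratedRep_iff (hb : IsBddApproxLeftId l b)
    (h : R.IsRContinuous μ ρ)
    (hn : IsNondegRep (R.integratedRep μ ρ h))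
    {Z : Submodule 𝕜 X} (hZ : IsClosed (Z : Set X)) :
    IsInvariantRep (R.integratedRep μ ρ h) Z ↔ ρ.IsInvariant Z := by
  have hT := R.isBddRep_integratedRep μ ρ h
  constructor
  · intro H
    refine ⟨fun a x hx => ?_, fun r x hx => ?_⟩
    · refine hZ.mem_of_tendsto (((ρ.pi a).continuous.tendsto x).comp (hb.tendsto_rep hT hn x))
        (Eventually.of_forall fun i => ?_)
      rw [Function.comp_apply, ← integratedRep_iA_apply]
      exact H _ x hx
    · refine hZ.mem_of_tendsto (((ρ.U r).continuous.tendsto x).comp (hb.tendsto_rep hT hn x))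
        (Eventually.of_forall fun i => ?_)
      rw [Function.comp_apply, ← integratedRep_iG_apply]
      exact H _ x hx
  · intro H c x hx
    refine R.CP_induction μ (P := fun c => R.integratedRep μ ρ h c x ∈ Z)
      (hZ.preimage (hT.continuous_apply x)) (fun f => ?_) c
    rw [integratedRep_q, CovRep.integrated_apply]
    exact vint_mem μ hZ (ρ.continuous_integrand h.1 f x) (ρ.hasCompactSupport_integrand f x)
      fun s => H.1 _ _ (H.2 s x hx)

/-- From `T` to `(π, U)` the relation is checked on the vectors `T(c) y` of the source, so only the
source has to be non-degenerate. In the other direction `Φ` passes through the integral. -/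
lemma intertwinesRep_integratedRep_iff (hb : IsBddApproxLeftId l b)
    (h : R.IsRContinuous μ ρ) (h' : R.IsRContinuous μ τ)
    (hn : IsNondegRep (R.integratedRep μ ρ h))
    (Φ : X →L[𝕜] Y) :
    IntertwinesRep (R.integratedRep μ ρ h) (R.integratedRep μ τ h') Φ ↔ ρ.Intertwines τ Φ := by
  have hT := R.isBddRep_integratedRep μ ρ h
  have hS := R.isBddRep_integratedRep μ τ h'
  constructor
  · intro H
    have H' : ∀ c x, R.integratedRep μ τ h' c (Φ x) = Φ (R.integratedRep μ ρ h c x) :=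
      fun c x => DFunLike.congr_fun (H c) x
    refine ⟨fun a => ContinuousLinearMap.ext ?_, fun r => ContinuousLinearMap.ext ?_⟩
    · refine hb.rep_induction hT hn (isClosed_eq (ContinuousLinearMap.continuous _)
        (ContinuousLinearMap.continuous _)) fun c y => ?_
      change τ.pi a (Φ _) = Φ (ρ.pi a _)
      rw [← H', ← integratedRep_iA_apply, H', integratedRep_iA_apply]
    · refine hb.rep_induction hT hn (isClosed_eq (ContinuousLinearMap.continuous _)
        (ContinuousLinearMap.continuous _)) fun c y => ?_
      change τ.U r (Φ _) = Φ (ρ.U r _)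
      rw [← H', ← integratedRep_iG_apply, H', integratedRep_iG_apply]
  · intro H c
    have H1 : ∀ a x, τ.pi a (Φ x) = Φ (ρ.pi a x) := fun a x => DFunLike.congr_fun (H.1 a) x
    have H2 : ∀ r x, τ.U r (Φ x) = Φ (ρ.U r x) := fun r x => DFunLike.congr_fun (H.2 r) x
    ext x
    change R.integratedRep μ τ h' c (Φ x) = Φ (R.integratedRep μ ρ h c x)
    refine R.CP_induction μ (isClosed_eq (hS.continuous_apply _)
      (Φ.continuous.comp (hT.continuous_apply x))) (fun f => ?_) c
    rw [Function.comp_apply, integratedRep_q, integratedRep_q, CovRep.integrated_apply,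
      CovRep.integrated_apply,
      ← vint_clm 𝕜 μ Φ (ρ.integrable_integrand h.1 μ f x)]
    simp only [H1, H2]

end Net

end RepClass

end System

/-! ### The involutive case -/

section Involutive

lemma continuous_coreInner {𝕜 X : Type*} [RCLike 𝕜] [NormedAddCommGroup X] [NormedSpace 𝕜 X]
    (c : InnerProductSpace.Core 𝕜 X) (hc : IsHilbertCore c) :
    Continuous fun p : X × X => c.inner p.1 p.2 := by
  let ip : InnerProductSpace 𝕜 X :=
    { (inferInstance : NormedSpace 𝕜 X), c with
      norm_sq_eq_re_inner := fun x => (hc x).symm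
      conj_inner_symm := c.conj_inner_symm
      add_left := c.add_left
      smul_left := c.smul_left }
  exact continuous_inner (𝕜 := 𝕜) (E := X)

variable {𝕜 A G : Type*} [RCLike 𝕜] [NonUnitalNormedRing A] [NormedSpace 𝕜 A]
  [StarRing A] [StarModule 𝕜 A] [Group G] [TopologicalSpace G] [IsTopologicalGroup G]
  [LocallyCompactSpace G] [CompleteSpace A] [MeasurableSpace G] [BorelSpace G]
  [IsScalarTower 𝕜 A A] [SMulCommClass 𝕜 A A] {D : DynSys 𝕜 A G} (hD : D.IsInvolutive)
  (μ : Measure G) [μ.IsHaarMeasure]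

lemma DynSys.act_mul_apply (D : DynSys 𝕜 A G) (s t : G) (a : A) :
    D.act (s * t) a = D.act s (D.act t a) := by
  rw [map_mul]; rfl

lemma DynSys.conv_apply (D : DynSys 𝕜 A G) (f g : C_c(G, A)) (s : G) :
    D.conv μ f g s = vint 𝕜 μ fun r => f r * D.act r (g (r⁻¹ * s)) := rfl

/-- This says that `i_A(star a)` is the formal adjoint of `i_A(a)` for the `A`-valued pairing `f^* *
g`. The integrands already agree pointwise. -/
lemma DynSys.conv_invol_iAfun (a : A) (f g : C_c(G, A)) :
    D.conv μ (D.invol hD (iAfun 𝕜 (star a) f)) g = D.conv μ (D.invol hD f) (iAfun 𝕜 a g) := by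
  ext s
  simp only [DynSys.conv_apply, DynSys.invol_apply, iAfun_apply, star_mul, star_star, D.act_mul,
    smul_mul_assoc, mul_assoc]

/-- Unitarity of `i_G(r)` for the pairing `f^* * g`. The modular factor turns the convolution into
`∫ k(s) ds`, and translating both functions by `r` replaces `k` by `k(r⁻¹ s)`, so left invariance
applies. -/
lemma DynSys.conv_invol_iGfun (r : G) (f g : C_c(G, A)) :
    D.conv μ (D.invol hD (iGfun D r f)) (iGfun D r g) = D.conv μ (D.invol hD f) g := by
  ext t
  let k : G → A := fun s => D.act s⁻¹ (star (f s)) * D.act s⁻¹ (g (s * t))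
  have hk : Continuous k := by
    have h1 : Continuous fun s : G => D.act s⁻¹ (star (f s)) :=
      D.continuous_uncurry.comp (f := fun s => (s⁻¹, star (f s)))
        (continuous_inv.prodMk (hD.continuous_star.comp f.continuous))
    have h2 : Continuous fun s : G => D.act s⁻¹ (g (s * t)) :=
      D.continuous_uncurry.comp (f := fun s => (s⁻¹, g (s * t))) (by fun_prop)
    exact h1.mul h2
  have hkc : HasCompactSupport k := f.hasCompactSupport.mono fun s hs hf => hs (by simp [k, hf])
  have hk' : Continuous fun s => k (r⁻¹ * s) := by fun_prop
  have hkc' : HasCompactSupport fun s => k (r⁻¹ * s) :=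
    hkc.comp_homeomorph (Homeomorph.mulLeft r⁻¹)
  have e1 : D.conv μ (D.invol hD f) g t = vint 𝕜 μ fun s => (modular s⁻¹ : 𝕜) • k s⁻¹ := by
    simp only [DynSys.conv_apply, DynSys.invol_apply, smul_mul_assoc, k, inv_inv]
  have e2 : D.conv μ (D.invol hD (iGfun D r f)) (iGfun D r g) t
      = vint 𝕜 μ fun s => (modular s⁻¹ : 𝕜) • k (r⁻¹ * s⁻¹) := by
    simp only [DynSys.conv_apply, DynSys.invol_apply, iGfun_apply, smul_mul_assoc, k, mul_inv_rev,
      inv_inv, DynSys.act_mul_apply, hD.act_star, mul_assoc]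
  rw [e1, e2, vint_modular_inv μ 𝕜 hk hkc,
    vint_modular_inv μ 𝕜 (f := fun s => k (r⁻¹ * s)) hk' hkc', vint_mul_left]

namespace RepClass

variable (R : RepClass.{v} D)

lemma cpStar_iA_mul (hR : R.IsInvolutive) (a : A) (b c : R.CP μ) :
    R.cpStar μ hD ((R.iA μ (star a)).1 b) * c = R.cpStar μ hD b * (R.iA μ a).1 c := by
  have hs := R.continuous_cpStar μ hD
  refine R.CP_induction μ (P := fun b => R.cpStar μ hD ((R.iA μ (star a)).1 b) * c =
    R.cpStar μ hD b * (R.iA μ a).1 c) (isClosed_eq (by fun_prop) (by fun_prop)) (fun f => ?_) b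
  refine R.CP_induction μ (P := fun c => R.cpStar μ hD ((R.iA μ (star a)).1 (R.q μ f)) * c =
    R.cpStar μ hD (R.q μ f) * (R.iA μ a).1 c) (isClosed_eq (by fun_prop) (by fun_prop))
    (fun g => ?_) c
  rw [iA_q, iA_q, cpStar_q _ _ _ hR, cpStar_q _ _ _ hR, q_mul_q, q_mul_q, D.conv_invol_iAfun]

lemma cpStar_iG_mul (hR : R.IsInvolutive) (r : G) (b c : R.CP μ) :
    R.cpStar μ hD ((R.iG μ r).1 b) * (R.iG μ r).1 c = R.cpStar μ hD b * c := by
  have hs := R.continuous_cpStar μ hD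
  refine R.CP_induction μ (P := fun b => R.cpStar μ hD ((R.iG μ r).1 b) * (R.iG μ r).1 c =
    R.cpStar μ hD b * c) (isClosed_eq (by fun_prop) (by fun_prop)) (fun f => ?_) b
  refine R.CP_induction μ (P := fun c => R.cpStar μ hD ((R.iG μ r).1 (R.q μ f)) * (R.iG μ r).1 c =
    R.cpStar μ hD (R.q μ f) * c) (isClosed_eq (by fun_prop) (by fun_prop))
    (fun g => ?_) c
  rw [iG_q, iG_q, cpStar_q _ _ _ hR, cpStar_q _ _ _ hR, q_mul_q, q_mul_q, D.conv_invol_iGfun]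

variable {X : Type*} [NormedAddCommGroup X] [NormedSpace 𝕜 X] [CompleteSpace X]

lemma isInvolutiveRep_integratedRep (hR : R.IsInvolutive) {ρ : CovRep D X} (h : R.IsRContinuous μ ρ)
    (hρ : ρ.IsInvolutive) : IsInvolutiveRep (R.cpStar μ hD) (R.integratedRep μ ρ h) := by
  obtain ⟨c, hc, hpi, hU⟩ := hρ
  have hT := R.isBddRep_integratedRep μ ρ h
  have hin := continuous_coreInner c hc
  refine ⟨c, hc, fun b x y => ?_⟩
  refine R.CP_induction μ (isClosed_eq
    (hin.comp (((hT.continuous_apply x).comp (R.continuous_cpStar μ hD)).prodMk continuous_const))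
    (hin.comp (continuous_const.prodMk (hT.continuous_apply y)))) (fun f => ?_) b
  simp only [Function.comp_apply]
  rw [cpStar_q _ _ _ hR, integratedRep_q, integratedRep_q]
  exact ρ.inner_integrated_invol hD h.1 μ c hc hpi hU f x y

/-- On the dense vectors, `⟨π(a^*) T(b) x, T(d) y⟩ = ⟨x, T((i_A(a^*) b)^* d) y⟩ = ⟨x, T(b^* i_A(a)
d) y⟩ = ⟨T(b) x, π(a) T(d) y⟩`; the computation for `U` is the same with `i_G`. -/
lemma isInvolutive_separatedRep (hR : R.IsInvolutive) {ι : Type*} {l : Filter ι} [l.NeBot] {e : ι → R.CP μ}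
    (he : IsBddApproxLeftId l e) {T : R.CP μ →ₙₐ[𝕜] (X →L[𝕜] X)} (hT : IsBddRep T)
    (hn : IsNondegRep T) (hTs : IsInvolutiveRep (R.cpStar μ hD) T) :
    (R.separatedRep μ T).IsInvolutive := by
  obtain ⟨c, hc, hst⟩ := hTs
  have hin := continuous_coreInner c hc
  -- Conjugate symmetry moves `T b` to the other side without using that the involution of `B`
  -- squares to the identity.
  have hst' : ∀ b x y, c.inner (T b x) y = c.inner x (T (R.cpStar μ hD b) y) := fun b x y => by
    rw [← c.conj_inner_symm, ← hst, c.conj_inner_symm]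
  refine ⟨c, hc, fun a => ?_, fun s => ?_⟩
  · refine he.rep_induction hT hn ?_ fun b x y => ?_
    · simp only [Set.ofPred_forall]
      exact isClosed_iInter fun y => isClosed_eq
        (hin.comp ((ContinuousLinearMap.continuous _).prodMk continuous_const))
        (hin.comp (continuous_id.prodMk continuous_const))
    revert y
    refine he.rep_induction hT hn (isClosed_eq
        (hin.comp (continuous_const.prodMk continuous_id))
        (hin.comp (continuous_const.prodMk (ContinuousLinearMap.continuous _)))) fun d y => ?_
    rw [R.separatedRep_pi_apply μ he hT hn, R.separatedRep_pi_apply μ he hT hn, hst', hst',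
      ← rep_mul_apply, ← rep_mul_apply, R.cpStar_iA_mul hD μ hR]
  · refine he.rep_induction hT hn ?_ fun b x y => ?_
    · simp only [Set.ofPred_forall]
      exact isClosed_iInter fun y => isClosed_eq
        (hin.comp ((ContinuousLinearMap.continuous _).prodMk continuous_const))
        (hin.comp (continuous_id.prodMk continuous_const))
    revert y
    refine he.rep_induction hT hn (isClosed_eq
        (hin.comp (continuous_const.prodMk (ContinuousLinearMap.continuous _)))
        (hin.comp (continuous_const.prodMk continuous_id))) fun d y => ?_
    rw [R.separatedRep_U_apply μ he hT hn, R.separatedRep_U_apply μ he hT hn, hst', hst',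
      ← rep_mul_apply, ← rep_mul_apply, R.cpStar_iG_mul hD μ hR]

end RepClass

end Involutive

end
end CrossedProd

/-! ### The correspondence theorem -/

theorem theoremt {𝕜 : Type u𝕜} {A : Type uA} {G : Type uG} [RCLike 𝕜]
    [NonUnitalNormedRing A] [NormedSpace 𝕜 A] [IsScalarTower 𝕜 A A] [SMulCommClass 𝕜 A A]
    [CompleteSpace A]
    [Group G] [TopologicalSpace G] [IsTopologicalGroup G] [LocallyCompactSpace G] [T2Space G]
    [MeasurableSpace G] [BorelSpace G] (μ : Measure G) [μ.IsHaarMeasure] [μ.Regular]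
    (D : DynSys 𝕜 A G) (hA : HasBoundedApproxLeftId A)
    (R : RepClass.{v} D) (hR : ∀ ρ ∈ R.carrier, ρ.2.IsNondeg)
    (𝓧 : Set (BanachSp.{u𝕜, w} 𝕜)) (h𝓧 : 𝓧.Nonempty) :
    -- `separation` is well-defined: there is a unique `T̄`, it is bounded, and the image
    -- of `T` is `(T̄ ∘ i_A, T̄ ∘ i_G)`
    (∀ T ∈ R.repSet μ 𝓧,
      ∃ Tbar : leftCentralizers 𝕜 (R.CP μ) →ₐ[𝕜] (T.1 →L[𝕜] T.1),
        R.Extends μ (Tbar : leftCentralizers 𝕜 (R.CP μ) →ₙₐ[𝕜] (T.1 →L[𝕜] T.1)) T.2 ∧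
        (∀ T' : leftCentralizers 𝕜 (R.CP μ) →ₙₐ[𝕜] (T.1 →L[𝕜] T.1),
          R.Extends μ T' T.2 → ∀ L, T' L = Tbar L) ∧
        (∃ C : ℝ, ∀ L, ‖Tbar L‖ ≤ C * ‖L‖) ∧
        R.separatedRep μ T.2 = R.ofCentralizers μ Tbar) ∧
    -- the two bijections, inverse to each other
    Set.BijOn (R.integration μ) (R.covRepSet μ 𝓧) (R.repSet μ 𝓧) ∧
    Set.BijOn (R.separation μ) (R.repSet μ 𝓧) (R.covRepSet μ 𝓧) ∧
    Set.InvOn (R.separation μ) (R.integration μ) (R.covRepSet μ 𝓧) (R.repSet μ 𝓧) ∧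
    -- closed invariant subspaces
    (∀ ρ ∈ R.covRepSet μ 𝓧, ∀ Z : Submodule 𝕜 ρ.1, IsClosed (Z : Set ρ.1) →
      (IsInvariantRep (X := ρ.1) (R.integration μ ρ).2 Z ↔ ρ.2.IsInvariant Z)) ∧
    (∀ T ∈ R.repSet μ 𝓧, ∀ Z : Submodule 𝕜 T.1, IsClosed (Z : Set T.1) →
      ((R.separatedRep μ T.2).IsInvariant Z ↔ IsInvariantRep T.2 Z)) ∧
    -- bounded intertwining operators
    (∀ ρ ∈ R.covRepSet μ 𝓧, ∀ τ ∈ R.covRepSet μ 𝓧, ∀ Φ : ρ.1 →L[𝕜] τ.1,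
      (IntertwinesRep (X := ρ.1) (Y := τ.1) (R.integration μ ρ).2 (R.integration μ τ).2 Φ ↔
        ρ.2.Intertwines τ.2 Φ)) ∧
    (∀ T ∈ R.repSet μ 𝓧, ∀ S ∈ R.repSet μ 𝓧, ∀ Φ : T.1 →L[𝕜] S.1,
      ((R.separatedRep μ T.2).Intertwines (R.separatedRep μ S.2) Φ ↔
        IntertwinesRep T.2 S.2 Φ)) ∧
    -- the involutive case
    (∀ [StarRing A] [StarModule 𝕜 A] (hD : D.IsInvolutive), R.IsInvolutive →
      (∀ ρ ∈ R.covRepSet μ 𝓧, ρ.2.IsInvolutive →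
        IsInvolutiveRep (R.cpStar μ hD) (R.integration μ ρ).2) ∧
      (∀ T ∈ R.repSet μ 𝓧, IsInvolutiveRep (R.cpStar μ hD) T.2 →
        (R.separatedRep μ T.2).IsInvolutive)) := by 
  obtain ⟨κ, m, e, _, he⟩ := hA.exists_isBddApproxLeftId
  obtain ⟨l, b, _, hb⟩ := R.exists_isBddApproxLeftId μ he
  have hint : ∀ {ρ : Σ X : BanachSp.{u𝕜, w} 𝕜, CovRep D X} (h : R.IsRContinuous μ ρ.2),
      R.integration μ ρ = ⟨ρ.1, R.integratedRep μ ρ.2 h⟩ := fun h => by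
    rw [RepClass.integration, dif_pos h]
  have hint2 : ∀ {ρ : Σ X : BanachSp.{u𝕜, w} 𝕜, CovRep D X} (h : R.IsRContinuous μ ρ.2),
      (R.integration μ ρ).2 = R.integratedRep μ ρ.2 h := fun h => dif_pos h
  have hnd : ∀ ρ ∈ R.covRepSet μ 𝓧, ∀ h : R.IsRContinuous μ ρ.2,
      IsNondegRep (R.integratedRep μ ρ.2 h) := fun ρ hρ h =>
    R.isNondegRep_integratedRep μ ρ.2 h hρ.2.1
  have hI : Set.MapsTo (R.integration μ) (R.covRepSet μ 𝓧) (R.repSet μ 𝓧) := fun ρ hρ => by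
    rw [hint hρ.2.2]
    exact ⟨hρ.1, hnd ρ hρ hρ.2.2, R.isBddRep_integratedRep μ ρ.2 hρ.2.2⟩
  have hSc : ∀ T ∈ R.repSet μ 𝓧, R.IsRContinuous μ (R.separatedRep μ T.2) := fun T hT =>
    R.isRContinuous_separatedRep μ hb hT.2.2 hT.2.1
  have hS : Set.MapsTo (R.separation μ) (R.repSet μ 𝓧) (R.covRepSet μ 𝓧) := fun T hT =>
    ⟨hT.1, R.isNondeg_separatedRep μ hb hT.2.2 hT.2.1 he, hSc T hT⟩
  -- Writing `T` as the integrated form of its separated pair deduces the preservation properties of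
  -- separation from those of integration.
  have hIS : ∀ T (hT : T ∈ R.repSet μ 𝓧), R.integratedRep μ _ (hSc T hT) = T.2 := fun T hT =>
    R.integratedRep_separatedRep μ hb hT.2.2 hT.2.1 _
  have hinv : Set.InvOn (R.separation μ) (R.integration μ) (R.covRepSet μ 𝓧) (R.repSet μ 𝓧) := by
    refine ⟨fun ρ hρ => ?_, fun T hT => ?_⟩
    · rw [hint hρ.2.2]
      exact congrArg (Sigma.mk ρ.1)
        (R.separatedRep_integratedRep μ hb hρ.2.2 (hnd ρ hρ _))
    · rw [hint (hSc T hT)]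
      exact congrArg (Sigma.mk T.1) (hIS T hT)
  have hndS : ∀ T (hT : T ∈ R.repSet μ 𝓧), IsNondegRep (R.integratedRep μ _ (hSc T hT)) :=
    fun T hT => hnd _ (hS hT) _
  refine ⟨fun T hT => ?_, hinv.bijOn hI hS, hinv.symm.bijOn hS hI, hinv,
    fun ρ hρ Z hZ => ?_, fun T hT Z hZ => ?_, fun ρ hρ τ hτ Φ => ?_, fun T hT S hS' Φ => ?_,
    fun hD hRs => ⟨fun ρ hρ hρs => ?_, fun T hT hTs => ?_⟩⟩
  · exact R.exists_separatedRep_eq μ hb hT.2.2 hT.2.1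
  · rw [hint2 hρ.2.2]
    exact R.isInvariantRep_integratedRep_iff μ hb hρ.2.2 (hnd ρ hρ _) hZ
  · rw [← R.isInvariantRep_integratedRep_iff μ hb (hSc T hT) (hndS T hT) hZ, hIS T hT]
  · rw [hint2 hρ.2.2, hint2 hτ.2.2]
    exact R.intertwinesRep_integratedRep_iff μ hb hρ.2.2 hτ.2.2 (hnd ρ hρ _) Φ
  · rw [← R.intertwinesRep_integratedRep_iff μ hb (hSc T hT) (hSc S hS') (hndS T hT) Φ,
      hIS T hT, hIS S hS']
  · rw [hint2 hρ.2.2]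
    exact R.isInvolutiveRep_integratedRep hD μ hRs hρ.2.2 hρs
  · exact R.isInvolutive_separatedRep hD μ hRs hb hT.2.2 hT.2.1 hTs
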